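/- Call a family of generators $G'_{n,k}:\{0,1\}^{r(n,k)}\to\{\pm1\}^n$ \emph{explicit} if a single random access machine program (unit cost per instruction; arithmetic consists of addition and truncated subtraction only) computes $G'_{n,k}(y)$ from $n$, $k$ and $y$ in time polynomial in $n$. There are constants $C, C_1, C_2>0$ and an explicit family of generators such that for every integer $n\ge 3$ and every real $\gamma\in(0,1)$, the generator $G'=G'_{n,k}$ with $k=\lceil\log_2(1/\gamma)\rceil$ has seed length $r'\le C\log(n/\gamma)\cdot\log\log n$, and for every unit vector $w\in\mathbb{R}^n$ (in the Euclidean norm), \[ \Pr_{y\in_u\{0,1\}^{r'}}\Bigl[\,|\langle w,G'(y)\rangle|\ \ge\ (C_1\log(n/\gamma))^{C_2\log\log n}\Bigr]\ \le\ \gamma . \] Here $\log$ is the natural logarithm. -/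

import Mathlib

/-- Programs of a random access machine with finitely many named variables and finitely many named
arrays (variables and arrays are numbered, and a program mentions only finitely many of them).
All cells hold natural numbers.  The only arithmetic is addition and truncated subtraction. -/
inductive RamProg : Type
  /-- `const x c`: set variable `x` to the constant `c`. -/
  | const (x c : ℕ) : RamProg
  /-- `add x y z`: `x := y + z`. -/
  | add (x y z : ℕ) : RamProg
  /-- `sub x y z`: `x := y - z`, truncated at `0`. -/
  | sub (x y z : ℕ) : RamProg
  /-- `load x a i`: `x := a[i]`, where `a` is an array and `x`, `i` are variables. -/
  | load (x a i : ℕ) : RamProg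
  /-- `store a i x`: `a[i] := x`, where `a` is an array and `x`, `i` are variables. -/
  | store (a i x : ℕ) : RamProg
  /-- First `p`, then `q`. -/
  | seq (p q : RamProg) : RamProg
  /-- If variable `x` is nonzero then `p`, else `q`. -/
  | cond (x : ℕ) (p q : RamProg) : RamProg
  /-- While variable `x` is nonzero, do `p`. -/
  | loop (x : ℕ) (p : RamProg) : RamProg

/-- A memory state: the values of the variables and the contents of the arrays. -/
structure RamState : Type where
  /-- The value of each variable. -/
  var : ℕ → ℕ
  /-- `arr a i` is the `i`-th cell of array `a`. -/
  arr : ℕ → ℕ → ℕ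

/-- The state after the assignment `x := v`. -/
def RamState.setVar (s : RamState) (x v : ℕ) : RamState :=
  ⟨Function.update s.var x v, s.arr⟩

/-- The state after the assignment `a[i] := v`. -/
def RamState.setArr (s : RamState) (a i v : ℕ) : RamState :=
  ⟨s.var, Function.update s.arr a (Function.update (s.arr a) i v)⟩

/-- `RamProg.Exec p s s' t`: program `p`, started in state `s`, halts in state `s'` after exactly
`t` steps; every assignment, load and store and every test of a condition is one step. -/
inductive RamProg.Exec : RamProg → RamState → RamState → ℕ → Prop
  | const (s : RamState) (x c : ℕ) : Exec (.const x c) s (s.setVar x c) 1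
  | add (s : RamState) (x y z : ℕ) :
      Exec (.add x y z) s (s.setVar x (s.var y + s.var z)) 1
  | sub (s : RamState) (x y z : ℕ) :
      Exec (.sub x y z) s (s.setVar x (s.var y - s.var z)) 1
  | load (s : RamState) (x a i : ℕ) :
      Exec (.load x a i) s (s.setVar x (s.arr a (s.var i))) 1
  | store (s : RamState) (a i x : ℕ) :
      Exec (.store a i x) s (s.setArr a (s.var i) (s.var x)) 1
  | seq {p q : RamProg} {s s' s'' : RamState} {t t' : ℕ} :
      Exec p s s' t → Exec q s' s'' t' → Exec (.seq p q) s s'' (t + t')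
  | cond_true {x : ℕ} {p q : RamProg} {s s' : RamState} {t : ℕ} :
      s.var x ≠ 0 → Exec p s s' t → Exec (.cond x p q) s s' (t + 1)
  | cond_false {x : ℕ} {p q : RamProg} {s s' : RamState} {t : ℕ} :
      s.var x = 0 → Exec q s s' t → Exec (.cond x p q) s s' (t + 1)
  | loop_stop {x : ℕ} {p : RamProg} {s : RamState} :
      s.var x = 0 → Exec (.loop x p) s s 1
  | loop_step {x : ℕ} {p : RamProg} {s s' s'' : RamState} {t t' : ℕ} :
      s.var x ≠ 0 → Exec p s s' t → Exec (.loop x p) s' s'' t' →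
        Exec (.loop x p) s s'' (t + t' + 1)

/-- The initial state on input `(n, k, y)`: variable `0` holds `n`, variable `1` holds `k`,
array `0` holds the bits of `y`, and everything else is `0`. -/
def ramInput (n k : ℕ) {r : ℕ} (y : Fin r → Bool) : RamState where
  var x := if x = 0 then n else if x = 1 then k else 0
  arr a i := if h : a = 0 ∧ i < r then (y ⟨i, h.2⟩).toNat else 0

/-- The sign vector `x ∈ {±1}ⁿ` is the output in state `s`: array `1` starts with `n` bits, where
the bit `0` stands for the sign `1` and the bit `1` for the sign `-1`. -/
def RamState.IsOutput (s : RamState) {n : ℕ} (x : Fin n → ℤˣ) : Prop :=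
  ∀ i : Fin n, s.arr 1 i = if x i = 1 then 0 else 1

/-- A family of generators `G n k : {0,1}^(r n k) → {±1}ⁿ`, indexed by the output length `n` and
an accuracy parameter `k`, is explicit if a single program computes `G n k y` from `n`, `k` and the
seed `y` in time polynomial in `n`. -/
def IsExplicitGenerator (r : ℕ → ℕ → ℕ)
    (G : (n k : ℕ) → (Fin (r n k) → Bool) → (Fin n → ℤˣ)) : Prop :=
  ∃ (P : RamProg) (T : Polynomial ℕ), ∀ (n k : ℕ) (y : Fin (r n k) → Bool),
    ∃ (s : RamState) (t : ℕ), P.Exec (ramInput n k y) s t ∧ t ≤ T.eval n ∧ s.IsOutput (G n k y)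

/-- The probability of the event `E` for a uniformly random seed `y ∈ {0,1}^r`. -/
noncomputable def seedProb {r : ℕ} (E : Set (Fin r → Bool)) : ℝ :=
  (E.ncard : ℝ) / 2 ^ r

/-- The least natural number `k` with `2⁻ᵏ ≤ γ`, for `0 < γ < 1`. -/
noncomputable def accuracyBits (γ : ℝ) : ℕ := ⌈Real.logb 2 (1 / γ)⌉₊

theorem RamState.setVar_var (s : RamState) (x v y : ℕ) :
    (s.setVar x v).var y = if y = x then v else s.var y := by
  simp [RamState.setVar, Function.update_apply]

theorem RamState.setVar_arr (s : RamState) (x v : ℕ) : (s.setVar x v).arr = s.arr := rfl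

/-- A family of memory contents, indexed by `Ω`: the cells of array `0` hold `input`, and the first
`numVars` variables (after renaming) hold `env`. Running times are measured in terms of `size`. -/
structure RamContext : Type 1 where
  /-- The index type of the family. -/
  Ω : Type
  /-- The parameter in which running times are polynomial. -/
  size : Ω → ℕ
  /-- The contents of array `0`. -/
  input : Ω → ℕ → ℕ
  /-- The number of variables with known contents. -/
  numVars : ℕ
  /-- The contents of the variables. -/
  env : Ω → ℕ → ℕ

/-- The state `s` holds the data of the instance `ω`, where variable `x` is stored in `ρ x`. -/
def RamContext.Matches (c : RamContext) (ω : c.Ω) (ρ : ℕ → ℕ) (s : RamState) : Prop :=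
  s.arr 0 = c.input ω ∧ ∀ x < c.numVars, s.var (ρ x) = c.env ω x

/-- Started in `s`, the program `P` takes at most `T` steps to put `v` into variable `b`, leaving
the arrays and the variables below `b` unchanged. -/
def RamProg.Yields (P : RamProg) (s : RamState) (b v T : ℕ) : Prop :=
  ∃ s' t, P.Exec s s' t ∧ t ≤ T ∧ s'.arr = s.arr ∧ (∀ x < b, s'.var x = s.var x) ∧ s'.var b = v

/-- The function `F` of the instance is computable in time polynomial in the size, by a program
that can be placed anywhere in the memory. -/
def PolyTime (c : RamContext) (F : c.Ω → ℕ) : Prop :=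
  ∃ (P : (ℕ → ℕ) → ℕ → RamProg) (T : Polynomial ℕ), ∀ (ρ : ℕ → ℕ) (b : ℕ),
    (∀ x < c.numVars, ρ x < b) → ∀ ω s, c.Matches ω ρ s →
      (P ρ b).Yields s b (F ω) (T.eval (c.size ω))

/-- The function `F` of the instance is bounded by a polynomial in the size. -/
def PolyBounded (c : RamContext) (F : c.Ω → ℕ) : Prop :=
  ∃ T : Polynomial ℕ, ∀ ω, F ω ≤ T.eval (c.size ω)

theorem RamContext.Matches.of_agree {c : RamContext} {ω : c.Ω} {ρ : ℕ → ℕ} {s s' : RamState}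
    {b : ℕ} (h : c.Matches ω ρ s) (hρ : ∀ x < c.numVars, ρ x < b) (harr : s'.arr = s.arr)
    (hvar : ∀ x < b, s'.var x = s.var x) : c.Matches ω ρ s' :=
  ⟨by rw [harr, h.1], fun x hx => by rw [hvar _ (hρ x hx), h.2 x hx]⟩

namespace PolyTime

variable {c : RamContext}

theorem congr {F G : c.Ω → ℕ} (h : PolyTime c F) (hFG : ∀ ω, F ω = G ω) : PolyTime c G := by
  have : F = G := funext hFG
  exact this ▸ h

theorem const (v : ℕ) : PolyTime c (fun _ => v) := by
  refine ⟨fun _ b => .const b v, 1, fun ρ b _ ω s _ => ⟨_, _, .const s b v, by simp, rfl, ?_, ?_⟩⟩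
  · intro x hx
    simp [RamState.setVar_var, hx.ne]
  · simp [RamState.setVar_var]

theorem envVar (x : ℕ) (hx : x < c.numVars) : PolyTime c (fun ω => c.env ω x) := by
  refine ⟨fun ρ b => .seq (.const b 0) (.add b (ρ x) b), 2, fun ρ b hρ ω s hs =>
    ⟨_, _, .seq (.const _ _ _) (.add _ _ _ _), ?_, rfl, ?_, ?_⟩⟩
  · norm_num
  · intro y hy
    simp [RamState.setVar_var, hy.ne]
  · simp [RamState.setVar_var, (hρ x hx).ne, hs.2 x hx]

theorem add {F G : c.Ω → ℕ} (hF : PolyTime c F) (hG : PolyTime c G) :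
    PolyTime c (fun ω => F ω + G ω) := by
  obtain ⟨P, T, hP⟩ := hF
  obtain ⟨P', T', hP'⟩ := hG
  refine ⟨fun ρ b => .seq (P ρ b) (.seq (P' ρ (b + 1)) (.add b b (b + 1))), T + T' + 1,
    fun ρ b hρ ω s hs => ?_⟩
  obtain ⟨s1, t1, he1, ht1, ha1, hv1, hr1⟩ := hP ρ b hρ ω s hs
  obtain ⟨s2, t2, he2, ht2, ha2, hv2, hr2⟩ := hP' ρ (b + 1) (fun x hx => (hρ x hx).trans (by simp))
    ω s1 (hs.of_agree hρ ha1 hv1)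
  refine ⟨_, _, .seq he1 (.seq he2 (.add _ _ _ _)), ?_, by rw [RamState.setVar_arr, ha2, ha1],
    ?_, ?_⟩
  · simp only [Polynomial.eval_add, Polynomial.eval_one]; omega
  · intro y hy
    simp [RamState.setVar_var, hy.ne, hv2 y (by omega), hv1 y hy]
  · simp [RamState.setVar_var, hr2, hv2 b (by omega), hr1]

theorem sub {F G : c.Ω → ℕ} (hF : PolyTime c F) (hG : PolyTime c G) :
    PolyTime c (fun ω => F ω - G ω) := by
  obtain ⟨P, T, hP⟩ := hF
  obtain ⟨P', T', hP'⟩ := hG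
  refine ⟨fun ρ b => .seq (P ρ b) (.seq (P' ρ (b + 1)) (.sub b b (b + 1))), T + T' + 1,
    fun ρ b hρ ω s hs => ?_⟩
  obtain ⟨s1, t1, he1, ht1, ha1, hv1, hr1⟩ := hP ρ b hρ ω s hs
  obtain ⟨s2, t2, he2, ht2, ha2, hv2, hr2⟩ := hP' ρ (b + 1) (fun x hx => (hρ x hx).trans (by simp))
    ω s1 (hs.of_agree hρ ha1 hv1)
  refine ⟨_, _, .seq he1 (.seq he2 (.sub _ _ _ _)), ?_, by rw [RamState.setVar_arr, ha2, ha1],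
    ?_, ?_⟩
  · simp only [Polynomial.eval_add, Polynomial.eval_one]; omega
  · intro y hy
    simp [RamState.setVar_var, hy.ne, hv2 y (by omega), hv1 y hy]
  · simp [RamState.setVar_var, hr2, hv2 b (by omega), hr1]

theorem load {F : c.Ω → ℕ} (hF : PolyTime c F) : PolyTime c (fun ω => c.input ω (F ω)) := by
  obtain ⟨P, T, hP⟩ := hF
  refine ⟨fun ρ b => .seq (P ρ b) (.load b 0 b), T + 1, fun ρ b hρ ω s hs => ?_⟩
  obtain ⟨s1, t1, he1, ht1, ha1, hv1, hr1⟩ := hP ρ b hρ ω s hs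
  refine ⟨_, _, .seq he1 (.load _ _ _ _), ?_, by rw [RamState.setVar_arr, ha1], ?_, ?_⟩
  · simp only [Polynomial.eval_add, Polynomial.eval_one]; omega
  · intro y hy
    simp [RamState.setVar_var, hy.ne, hv1 y hy]
  · simp [RamState.setVar_var, hr1, ha1, hs.1]

end PolyTime

/-- The instances that satisfy `p`. -/
def RamContext.restrict (c : RamContext) (p : c.Ω → Prop) : RamContext where
  Ω := {ω // p ω}
  size ω := c.size ω.1
  input ω := c.input ω.1
  numVars := c.numVars
  env ω := c.env ω.1

/-- The context of the body of a loop with `cnt` rounds: two new variables hold the number `t` of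
the round and the intermediate result `iter t`. -/
def RamContext.round (c : RamContext) (cnt : c.Ω → ℕ) (iter : c.Ω → ℕ → ℕ) : RamContext where
  Ω := {z : c.Ω × ℕ // z.2 < cnt z.1}
  size z := c.size z.1.1
  input z := c.input z.1.1
  numVars := c.numVars + 2
  env z x := if x < c.numVars then c.env z.1.1 x else
    if x = c.numVars then z.1.2 else iter z.1.1 z.1.2

namespace PolyTime

variable {c : RamContext}

theorem restrict {F : c.Ω → ℕ} (h : PolyTime c F) (p : c.Ω → Prop) :
    PolyTime (c.restrict p) (fun ω => F ω.1) := by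
  obtain ⟨P, T, hP⟩ := h
  exact ⟨P, T, fun ρ b hρ ω s hs => hP ρ b hρ ω.1 s hs⟩

theorem round {F : c.Ω → ℕ} (h : PolyTime c F) (cnt : c.Ω → ℕ) (iter : c.Ω → ℕ → ℕ) :
    PolyTime (c.round cnt iter) (fun z => F z.1.1) := by
  obtain ⟨P, T, hP⟩ := h
  refine ⟨P, T, fun ρ b hρ ω s hs => hP ρ b (fun x hx => hρ x ?_) ω.1.1 s ⟨hs.1, fun x hx => ?_⟩⟩
  · exact hx.trans (by simp [RamContext.round])
  · rw [hs.2 x (hx.trans (by simp [RamContext.round]))]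
    simp [RamContext.round, hx]

theorem index (cnt : c.Ω → ℕ) (iter : c.Ω → ℕ → ℕ) :
    PolyTime (c.round cnt iter) (fun z => z.1.2) :=
  (PolyTime.envVar (c := c.round cnt iter) c.numVars (by simp [RamContext.round])).congr
    (fun z => by simp [RamContext.round])

theorem accumulator (cnt : c.Ω → ℕ) (iter : c.Ω → ℕ → ℕ) :
    PolyTime (c.round cnt iter) (fun z => iter z.1.1 z.1.2) :=
  (PolyTime.envVar (c := c.round cnt iter) (c.numVars + 1) (by simp [RamContext.round])).congr
    (fun z => by simp [RamContext.round])

theorem ite_zero {F G H : c.Ω → ℕ} (hF : PolyTime c F)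
    (hG : PolyTime (c.restrict fun ω => F ω = 0) (fun ω => G ω.1))
    (hH : PolyTime (c.restrict fun ω => F ω ≠ 0) (fun ω => H ω.1)) :
    PolyTime c (fun ω => if F ω = 0 then G ω else H ω) := by
  obtain ⟨P, T, hP⟩ := hF
  obtain ⟨P1, T1, hP1⟩ := hG
  obtain ⟨P2, T2, hP2⟩ := hH
  refine ⟨fun ρ b => .seq (P ρ b) (.cond b (P2 ρ b) (P1 ρ b)), T + T1 + T2 + 1,
    fun ρ b hρ ω s hs => ?_⟩
  obtain ⟨s1, t1, he1, ht1, ha1, hv1, hr1⟩ := hP ρ b hρ ω s hs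
  by_cases h0 : F ω = 0
  · obtain ⟨s2, t2, he2, ht2, ha2, hv2, hr2⟩ := hP1 ρ b hρ ⟨ω, h0⟩ s1 (hs.of_agree hρ ha1 hv1)
    refine ⟨s2, _, .seq he1 (.cond_false (by rw [hr1, h0]) he2), ?_, by rw [ha2, ha1],
      fun x hx => by rw [hv2 x hx, hv1 x hx], by simp [h0, hr2]⟩
    simp only [Polynomial.eval_add, Polynomial.eval_one, RamContext.restrict] at *; omega
  · obtain ⟨s2, t2, he2, ht2, ha2, hv2, hr2⟩ := hP2 ρ b hρ ⟨ω, h0⟩ s1 (hs.of_agree hρ ha1 hv1)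
    refine ⟨s2, _, .seq he1 (.cond_true (by rwa [hr1]) he2), ?_, by rw [ha2, ha1],
      fun x hx => by rw [hv2 x hx, hv1 x hx], by simp [h0, hr2]⟩
    simp only [Polynomial.eval_add, Polynomial.eval_one, RamContext.restrict] at *; omega

theorem iterate {cnt : c.Ω → ℕ} {iter : c.Ω → ℕ → ℕ} (hcnt : PolyTime c cnt)
    (hbd : PolyBounded c cnt) (h0 : PolyTime c (fun ω => iter ω 0))
    (hstep : PolyTime (c.round cnt iter) (fun z => iter z.1.1 (z.1.2 + 1))) :
    PolyTime c (fun ω => iter ω (cnt ω)) := by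
  obtain ⟨P, T, hP⟩ := hcnt
  obtain ⟨P0, T0, hP0⟩ := h0
  obtain ⟨P1, T1, hP1⟩ := hstep
  obtain ⟨B, hB⟩ := hbd
  let body : (ℕ → ℕ) → ℕ → RamProg := fun ρ b =>
    .seq (P1 (fun x => if x < c.numVars then ρ x else if x = c.numVars then b + 2 else b + 1)
      (b + 3)) (.seq (.const (b + 4) 0) (.seq (.add (b + 1) (b + 3) (b + 4))
      (.seq (.const (b + 4) 1) (.seq (.add (b + 2) (b + 2) (b + 4)) (.sub b b (b + 4))))))
  refine ⟨fun ρ b => .seq (P ρ b) (.seq (P0 ρ (b + 1)) (.seq (.const (b + 2) 0)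
    (.seq (.loop b (body ρ b)) (.seq (.const (b + 2) 0) (.add b (b + 1) (b + 2)))))),
    T + T0 + B * (T1 + 6) + 4, fun ρ b hρ ω s hs => ?_⟩
  have key : ∀ r t (σ : RamState), t + r = cnt ω → σ.var b = r → σ.var (b + 1) = iter ω t →
      σ.var (b + 2) = t → σ.arr = s.arr → (∀ x < b, σ.var x = s.var x) →
      ∃ σ' τ, (RamProg.loop b (body ρ b)).Exec σ σ' τ ∧ τ ≤ r * (T1.eval (c.size ω) + 6) + 1 ∧
        σ'.var (b + 1) = iter ω (cnt ω) ∧ σ'.arr = s.arr ∧ (∀ x < b, σ'.var x = s.var x) := by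
    intro r
    induction r with
    | zero =>
      intro t σ ht hb h1 _ ha hv
      exact ⟨σ, 1, RamProg.Exec.loop_stop hb, by simp, by rw [h1, ← ht, add_zero], ha, hv⟩
    | succ r ih =>
      intro t σ ht hb h1 h2 ha hv
      obtain ⟨σ1, t1, he1, ht1, ha1, hv1, hr1⟩ := hP1
        (fun x => if x < c.numVars then ρ x else if x = c.numVars then b + 2 else b + 1) (b + 3)
        (by
          intro x _
          split_ifs with h h'
          · exact (hρ x h).trans (by omega)
          · omega
          · omega)
        ⟨(ω, t), by simp only; omega⟩ σ
        ⟨by rw [ha]; exact hs.1, by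
          intro x _
          simp only [RamContext.round]
          split_ifs with h h'
          · rw [hv _ (hρ x h), hs.2 x h]
          · exact h2
          · exact h1⟩
      obtain ⟨σ', hexec, hb', h1', h2', ha', hv'⟩ : ∃ σ', (body ρ b).Exec σ σ' (t1 + 5) ∧
          σ'.var b = r ∧ σ'.var (b + 1) = iter ω (t + 1) ∧ σ'.var (b + 2) = t + 1 ∧
          σ'.arr = s.arr ∧ ∀ x < b, σ'.var x = s.var x := by
        refine ⟨_, .seq he1 (.seq (.const _ _ _) (.seq (.add _ _ _ _) (.seq (.const _ _ _)
          (.seq (.add _ _ _ _) (.sub _ _ _ _))))), ?_, ?_, ?_, ?_, ?_⟩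
        · simp [RamState.setVar_var, hv1 b (by omega), hb]
        · simp [RamState.setVar_var, hr1]
        · simp [RamState.setVar_var, hv1 (b + 2) (by omega), h2]
        · simp [RamState.setVar_arr, ha1, ha]
        · intro x hx
          simp [RamState.setVar_var, hx.ne, show x ≠ b + 4 by omega, show x ≠ b + 2 by omega,
            show x ≠ b + 1 by omega, hv1 x (by omega), hv x hx]
      obtain ⟨σ2, t2, he2, ht2, hr2, ha2, hv2⟩ := ih (t + 1) σ' (by omega) hb' h1' h2' ha' hv'
      refine ⟨σ2, _, .loop_step (by rw [hb]; omega) hexec he2, ?_, hr2, ha2, hv2⟩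
      simp only [RamContext.round] at ht1
      rw [add_mul, one_mul]
      omega
  obtain ⟨s1, t1, he1, ht1, ha1, hv1, hr1⟩ := hP ρ b hρ ω s hs
  obtain ⟨s2, t2, he2, ht2, ha2, hv2, hr2⟩ := hP0 ρ (b + 1)
    (fun x hx => (hρ x hx).trans (by simp)) ω s1 (hs.of_agree hρ ha1 hv1)
  obtain ⟨s3, t3, he3, ht3, hr3, ha3, hv3⟩ := key (cnt ω) 0 (s2.setVar (b + 2) 0) (by simp)
    (by simp [RamState.setVar_var, hv2 b (by omega), hr1])
    (by simp [RamState.setVar_var, hr2]) (by simp [RamState.setVar_var])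
    (by rw [RamState.setVar_arr, ha2, ha1])
    (by
      intro x hx
      simp [RamState.setVar_var, show x ≠ b + 2 by omega, hv2 x (by omega), hv1 x hx])
  refine ⟨_, _, .seq he1 (.seq he2 (.seq (.const _ _ _) (.seq he3 (.seq (.const _ _ _)
    (.add _ _ _ _))))), ?_, by simp only [RamState.setVar_arr, ha3], ?_, ?_⟩
  · have : cnt ω * (T1.eval (c.size ω) + 6) ≤ B.eval (c.size ω) * (T1.eval (c.size ω) + 6) :=
      Nat.mul_le_mul_right _ (hB ω)
    simp only [Polynomial.eval_add, Polynomial.eval_mul, Polynomial.eval_ofNat]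
    omega
  · intro y hy
    simp [RamState.setVar_var, hy.ne, show y ≠ b + 2 by omega, hv3 y hy]
  · simp [RamState.setVar_var, hr3]

end PolyTime

namespace PolyBounded

variable {c : RamContext}

theorem mono {F G : c.Ω → ℕ} (hG : PolyBounded c G) (h : ∀ ω, F ω ≤ G ω) : PolyBounded c F := by
  obtain ⟨T, hT⟩ := hG
  exact ⟨T, fun ω => (h ω).trans (hT ω)⟩

theorem const (v : ℕ) : PolyBounded c (fun _ => v) := ⟨Polynomial.C v, fun ω => by simp⟩

theorem size : PolyBounded c c.size := ⟨Polynomial.X, fun ω => by simp⟩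

theorem add {F G : c.Ω → ℕ} (hF : PolyBounded c F) (hG : PolyBounded c G) :
    PolyBounded c (fun ω => F ω + G ω) := by
  obtain ⟨T, hT⟩ := hF
  obtain ⟨T', hT'⟩ := hG
  exact ⟨T + T', fun ω => by simpa using add_le_add (hT ω) (hT' ω)⟩

theorem mul {F G : c.Ω → ℕ} (hF : PolyBounded c F) (hG : PolyBounded c G) :
    PolyBounded c (fun ω => F ω * G ω) := by
  obtain ⟨T, hT⟩ := hF
  obtain ⟨T', hT'⟩ := hG
  exact ⟨T * T', fun ω => by simpa using Nat.mul_le_mul (hT ω) (hT' ω)⟩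

theorem restrict {F : c.Ω → ℕ} (hF : PolyBounded c F) (p : c.Ω → Prop) :
    PolyBounded (c.restrict p) (fun ω => F ω.1) := by
  obtain ⟨T, hT⟩ := hF
  exact ⟨T, fun ω => hT ω.1⟩

theorem round {F : c.Ω → ℕ} (hF : PolyBounded c F) (cnt : c.Ω → ℕ) (iter : c.Ω → ℕ → ℕ) :
    PolyBounded (c.round cnt iter) (fun z => F z.1.1) := by
  obtain ⟨T, hT⟩ := hF
  exact ⟨T, fun z => hT z.1.1⟩

theorem index {cnt : c.Ω → ℕ} (h : PolyBounded c cnt) (iter : c.Ω → ℕ → ℕ) :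
    PolyBounded (c.round cnt iter) (fun z => z.1.2) :=
  (h.round cnt iter).mono fun z => z.2.le

end PolyBounded

theorem clog_le_self (n : ℕ) : Nat.clog 2 n ≤ n :=
  (Nat.clog_le_iff_le_pow (by norm_num)).mpr Nat.lt_two_pow_self.le

theorem Nat.succ_mod_eq_ite (t g : ℕ) :
    (t + 1) % g = if t % g + 1 = g then 0 else t % g + 1 := by
  rw [Nat.add_mod]
  rcases Nat.lt_trichotomy g 1 with h | rfl | h
  · obtain rfl : g = 0 := by omega
    simp
  · simp [Nat.mod_one]
  · rw [Nat.mod_eq_of_lt h]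
    have := Nat.mod_lt t (show 0 < g by omega)
    split_ifs with h'
    · simp [h']
    · rw [Nat.mod_eq_of_lt (by omega)]

namespace PolyTime

variable {c : RamContext}

theorem ite {p : c.Ω → Prop} [DecidablePred p] {F G : c.Ω → ℕ}
    (hp : PolyTime c (fun ω => if p ω then 1 else 0)) (hF : PolyTime c F) (hG : PolyTime c G) :
    PolyTime c (fun ω => if p ω then F ω else G ω) :=
  (ite_zero hp (hG.restrict _) (hF.restrict _)).congr fun ω => by by_cases h : p ω <;> simp [h]

theorem lt {F G : c.Ω → ℕ} (hF : PolyTime c F) (hG : PolyTime c G) :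
    PolyTime c (fun ω => if F ω < G ω then 1 else 0) :=
  (ite_zero (G := fun _ => 0) (H := fun _ => 1) (hG.sub hF) ((const 0).restrict _)
    ((const 1).restrict _)).congr fun ω => by
    by_cases h : F ω < G ω
    · simp [h, Nat.sub_ne_zero_of_lt h]
    · simp [h, Nat.sub_eq_zero_of_le (not_lt.mp h)]

theorem eq_zero {F : c.Ω → ℕ} (hF : PolyTime c F) :
    PolyTime c (fun ω => if F ω = 0 then 1 else 0) :=
  ite_zero hF ((const 1).restrict _) ((const 0).restrict _)

theorem eq {F G : c.Ω → ℕ} (hF : PolyTime c F) (hG : PolyTime c G) :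
    PolyTime c (fun ω => if F ω = G ω then 1 else 0) :=
  ((hF.sub hG).add (hG.sub hF)).eq_zero.congr fun ω => by
    congr 1
    exact propext ⟨fun h => by omega, fun h => by omega⟩

theorem sum {cnt : c.Ω → ℕ} {F : c.Ω → ℕ → ℕ} (hcnt : PolyTime c cnt) (hbd : PolyBounded c cnt)
    (hF : PolyTime (c.round cnt fun ω t => ∑ j ∈ Finset.range t, F ω j)
      (fun z => F z.1.1 z.1.2)) :
    PolyTime c (fun ω => ∑ j ∈ Finset.range (cnt ω), F ω j) :=
  iterate hcnt hbd ((const 0).congr fun ω => by simp)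
    (((accumulator _ _).add hF).congr fun z => by rw [Finset.sum_range_succ])

theorem mul {F G : c.Ω → ℕ} (hF : PolyTime c F) (hG : PolyTime c G) (hbd : PolyBounded c G) :
    PolyTime c (fun ω => F ω * G ω) :=
  (sum (F := fun ω _ => F ω) hG hbd (hF.round _ _)).congr fun ω => by simp [mul_comm]

theorem pow {F G : c.Ω → ℕ} (hF : PolyTime c F) (hG : PolyTime c G) (hFb : PolyBounded c F)
    (hGb : PolyBounded c G) : PolyTime c (fun ω => F ω ^ G ω) :=
  iterate (iter := fun ω t => F ω ^ t) hG hGb ((const 1).congr fun ω => by simp)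
    (((accumulator _ _).mul (hF.round _ _) (hFb.round _ _)).congr fun z => by rw [pow_succ])

theorem mod {F G : c.Ω → ℕ} (hF : PolyTime c F) (hG : PolyTime c G) (hFb : PolyBounded c F) :
    PolyTime c (fun ω => F ω % G ω) := by
  refine iterate (iter := fun ω t => t % G ω) hF hFb ((const 0).congr fun ω => by simp) ?_
  refine (ite (((accumulator _ _).add (const 1)).eq (hG.round _ _)) (const 0)
    ((accumulator _ _).add (const 1))).congr fun z => ?_
  exact (Nat.succ_mod_eq_ite _ _).symm

theorem div {F G : c.Ω → ℕ} (hF : PolyTime c F) (hG : PolyTime c G) (hFb : PolyBounded c F) :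
    PolyTime c (fun ω => F ω / G ω) := by
  refine iterate (iter := fun ω t => t / G ω) hF hFb ((const 0).congr fun ω => by simp) ?_
  refine ((accumulator _ _).add ((((index _ _).add (const 1)).mod (hG.round _ _)
    ((hFb.index _).add (.const 1))).eq_zero)).congr fun z => ?_
  simp only [Nat.succ_div, Nat.dvd_iff_mod_eq_zero]

theorem clog {F : c.Ω → ℕ} (hF : PolyTime c F) (hFb : PolyBounded c F) :
    PolyTime c (fun ω => Nat.clog 2 (F ω)) := by
  refine (iterate (iter := fun ω t => min t (Nat.clog 2 (F ω))) hF hFb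
    ((const 0).congr fun ω => by simp) ?_).congr fun ω => min_eq_right (clog_le_self _)
  refine (ite (((const 2).pow (accumulator _ _) (.const 2) ?_).lt (hF.round _ _))
    ((accumulator _ _).add (const 1)) (accumulator _ _)).congr fun z => ?_
  · exact (hFb.round _ _).mono fun z => (min_le_right _ _).trans (clog_le_self _)
  · simp only [← Nat.lt_clog_iff_pow_lt (show 1 < 2 by norm_num)]
    split_ifs <;> omega

theorem prime {F : c.Ω → ℕ} (hF : PolyTime c F) (hFb : PolyBounded c F) :
    PolyTime c (fun ω => if (F ω).Prime then 1 else 0) := by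
  have h : PolyTime c (fun ω => ∑ a ∈ Finset.range (F ω),
      if 1 < a then if F ω % a = 0 then 1 else 0 else 0) :=
    sum hF hFb (ite ((const 1).lt (index _ _))
      ((hF.round _ _).mod (index _ _) (hFb.round _ _)).eq_zero (const 0))
  refine (ite ((const 1).lt hF) h.eq_zero (const 0)).congr fun ω => ?_
  have key : (F ω).Prime ↔ 1 < F ω ∧ (∑ a ∈ Finset.range (F ω),
      if 1 < a then if F ω % a = 0 then 1 else 0 else 0) = 0 := by
    rw [Nat.prime_def_lt, Finset.sum_eq_zero_iff]
    refine and_congr Iff.rfl (forall_congr' fun a => ?_)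
    rw [Finset.mem_range, Nat.dvd_iff_mod_eq_zero]
    constructor
    · intro h ha
      split_ifs with h1 h2
      · have := h ha h2; omega
      · rfl
      · rfl
    · intro h ha h0
      have h1 := h ha
      rw [if_pos h0] at h1
      by_contra hne
      have : a ≠ 0 := by rintro rfl; simp at h0; omega
      rw [if_pos (by omega)] at h1
      exact one_ne_zero h1
  by_cases h1 : 1 < F ω <;> simp only [key, h1, if_true, if_false, true_and, false_and]

end PolyTime

/-- The first prime in `N, N + 1, …, N + t`, or `N + t` if there is none. -/
def primeFrom (N : ℕ) : ℕ → ℕ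
  | 0 => N
  | t + 1 => if (primeFrom N t).Prime then primeFrom N t else primeFrom N t + 1

/-- A prime between `N` and `2 * N`. -/
def fieldSize (N : ℕ) : ℕ := primeFrom N N

theorem primeFrom_bounds (N t : ℕ) : N ≤ primeFrom N t ∧ primeFrom N t ≤ N + t ∧
    ((primeFrom N t).Prime ∨ primeFrom N t = N + t ∧ ∀ x, N ≤ x → x < N + t → ¬ x.Prime) := by
  induction t with
  | zero => exact ⟨le_rfl, le_rfl, .inr ⟨rfl, fun x h1 h2 => by omega⟩⟩
  | succ t ih =>
    obtain ⟨h1, h2, h3⟩ := ih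
    rw [primeFrom]
    split_ifs with h
    · exact ⟨h1, by omega, .inl h⟩
    · obtain ⟨h4, h5⟩ := h3.resolve_left h
      refine ⟨by omega, by omega, .inr ⟨by omega, fun x hx hx' => ?_⟩⟩
      by_cases hx2 : x < N + t
      · exact h5 x hx hx2
      · obtain rfl : x = primeFrom N t := by omega
        exact h

theorem le_fieldSize (N : ℕ) : N ≤ fieldSize N := (primeFrom_bounds N N).1

theorem fieldSize_le (N : ℕ) : fieldSize N ≤ 2 * N := by
  have := (primeFrom_bounds N N).2.1
  rw [fieldSize]; omega

theorem fieldSize_prime {N : ℕ} (hN : N ≠ 0) : (fieldSize N).Prime := by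
  rcases (primeFrom_bounds N N).2.2 with h | ⟨h1, h2⟩
  · exact h
  · obtain ⟨x, hx, hx1, hx2⟩ := Nat.exists_prime_lt_and_le_two_mul N hN
    rcases hx2.lt_or_eq with h | h
    · exact absurd hx (h2 x hx1.le (by omega))
    · rw [fieldSize, h1, ← two_mul, ← h]
      exact hx

theorem PolyTime.fieldSize {c : RamContext} {F : c.Ω → ℕ} (hF : PolyTime c F)
    (hFb : PolyBounded c F) : PolyTime c (fun ω => fieldSize (F ω)) := by
  refine iterate (iter := fun ω t => primeFrom (F ω) t) hF hFb (hF.congr fun ω => rfl) ?_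
  refine (ite (prime (accumulator _ _) ?_) (accumulator _ _)
    ((accumulator _ _).add (const 1))).congr fun z => rfl
  exact ((hFb.round _ _).add (hFb.index _)).mono fun z => (primeFrom_bounds _ _).2.1

/-- The `j`-th block of `b` bits of `Y`, read as a binary number. -/
def blockValue (Y : ℕ → ℕ) (b j : ℕ) : ℕ := ∑ t ∈ Finset.range b, Y (j * b + t) * 2 ^ t

/-- The value at `x` modulo `p` of the polynomial whose `d` coefficients are blocks of `Y`. -/
def polyValue (p d b : ℕ) (Y : ℕ → ℕ) (x : ℕ) : ℕ :=
  (∑ j ∈ Finset.range d, blockValue Y b j * x ^ j) % p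

/-- The bucket in `[2 ^ 2 ^ (e - 1)]` to which the seed `Y` assigns `x ∈ [2 ^ 2 ^ e]`. -/
def levelHash (e q : ℕ) (Y : ℕ → ℕ) (x : ℕ) : ℕ :=
  polyValue (fieldSize (2 ^ 2 ^ e)) (2 * q) (2 ^ (e + 1)) Y x % 2 ^ 2 ^ (e - 1)

/-- The sign bit that the seed `Y` assigns to `x ∈ [2 ^ 2 ^ e]`. -/
def levelBit (e q : ℕ) (Y : ℕ → ℕ) (x : ℕ) : ℕ :=
  polyValue (fieldSize (2 ^ 2 ^ e)) (2 * q) (2 ^ (e + 1))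
    (fun t => Y (2 * q * 2 ^ (e + 1) + t)) x % 2

/-- The number of seed bits of one level. -/
def levelSeed (e q : ℕ) : ℕ := 2 * (2 * q * 2 ^ (e + 1))

/-- The bucket of `i` after `l` levels, starting from level `e`. -/
def walk (e q : ℕ) (Y : ℕ → ℕ) (i : ℕ) : ℕ → ℕ
  | 0 => i
  | l + 1 => levelHash (e - l) (q * 2 ^ l) (fun t => Y (l * levelSeed e q + t)) (walk e q Y i l)

/-- The number of minus signs that `i` collects on `t` levels, starting from level `e`. -/
def signExp (t e q : ℕ) (Y : ℕ → ℕ) (i : ℕ) : ℕ :=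
  ∑ l ∈ Finset.range t,
    levelBit (e - l) (q * 2 ^ l) (fun t => Y (l * levelSeed e q + t)) (walk e q Y i l)

/-- The least `e` with `n ≤ 2 ^ 2 ^ e`. -/
def topLevel (n : ℕ) : ℕ := Nat.clog 2 (Nat.clog 2 n)

/-- The moment used on the first level. -/
def topMoment (n k : ℕ) : ℕ := 4 * (k / 2 ^ topLevel n + 1) + 8

/-- The seed length of the generator. -/
def seedLength (n k : ℕ) : ℕ :=
  if k < n then (topLevel n - 4) * levelSeed (topLevel n) (topMoment n k) else 0

/-- The bits of a finite seed, followed by zeros. -/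
def seedBits {r : ℕ} (y : Fin r → Bool) (i : ℕ) : ℕ := if h : i < r then (y ⟨i, h⟩).toNat else 0

/-- The sign bits of the generator. -/
def generatorBit (n k : ℕ) (Y : ℕ → ℕ) (i : ℕ) : ℕ :=
  if k < n then signExp (topLevel n - 4) (topLevel n) (topMoment n k) Y i % 2 else 0

/-- The generator. -/
def generator (n k : ℕ) (y : Fin (seedLength n k) → Bool) (i : Fin n) : ℤˣ :=
  if generatorBit n k (seedBits y) i = 0 then 1 else -1

theorem seedBits_le_one {r : ℕ} (y : Fin r → Bool) (i : ℕ) : seedBits y i ≤ 1 := by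
  unfold seedBits
  split_ifs
  · exact Bool.toNat_le _
  · exact zero_le_one

theorem blockValue_lt {Y : ℕ → ℕ} (hY : ∀ i, Y i ≤ 1) (b j : ℕ) : blockValue Y b j < 2 ^ b := by
  have h : blockValue Y b j ≤ ∑ t ∈ Finset.range b, 2 ^ t :=
    Finset.sum_le_sum fun t _ => (Nat.mul_le_mul_right _ (hY _)).trans (one_mul _).le
  refine h.trans_lt ?_
  rw [Nat.geomSum_eq le_rfl]
  have := Nat.two_pow_pos b
  simp

theorem two_pow_topLevel_le (n : ℕ) : 2 ^ topLevel n ≤ 2 * Nat.clog 2 n + 1 := by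
  rcases Nat.lt_or_ge 1 (Nat.clog 2 n) with h | h
  · have := Nat.pow_pred_clog_lt_self (b := 2) (by norm_num) h
    have h2 : 0 < Nat.clog 2 (Nat.clog 2 n) := Nat.clog_pos (by norm_num) h
    have : 2 ^ topLevel n = 2 * 2 ^ (Nat.clog 2 (Nat.clog 2 n)).pred := by
      rw [← pow_succ', topLevel]; congr 1; exact (Nat.succ_pred_eq_of_pos h2).symm
    omega
  · rw [topLevel, Nat.clog_of_right_le_one h]
    simp

theorem two_pow_clog_le (n : ℕ) : 2 ^ Nat.clog 2 n ≤ 2 * n + 1 := by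
  rcases Nat.lt_or_ge 1 n with h | h
  · have := Nat.pow_pred_clog_lt_self (b := 2) (by norm_num) h
    have h2 : 0 < Nat.clog 2 n := Nat.clog_pos (by norm_num) h
    have : 2 ^ Nat.clog 2 n = 2 * 2 ^ (Nat.clog 2 n).pred := by
      rw [← pow_succ']; congr 1; exact (Nat.succ_pred_eq_of_pos h2).symm
    omega
  · rw [Nat.clog_of_right_le_one h]
    simp

theorem two_pow_two_pow_topLevel_le (n : ℕ) : 2 ^ 2 ^ topLevel n ≤ 2 * (2 * n + 1) ^ 2 :=
  calc 2 ^ 2 ^ topLevel n ≤ 2 ^ (2 * Nat.clog 2 n + 1) :=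
        Nat.pow_le_pow_right (by norm_num) (two_pow_topLevel_le n)
    _ = 2 * (2 ^ Nat.clog 2 n) ^ 2 := by rw [pow_succ', ← pow_mul, mul_comm (Nat.clog 2 n)]
    _ ≤ 2 * (2 * n + 1) ^ 2 :=
      Nat.mul_le_mul_left _ (Nat.pow_le_pow_left (two_pow_clog_le n) 2)

namespace PolyTime

variable {c : RamContext}

theorem blockValue {o b j : c.Ω → ℕ} (ho : PolyTime c o) (hb : PolyTime c b) (hj : PolyTime c j)
    (hbb : PolyBounded c fun ω => 2 ^ b ω) :
    PolyTime c (fun ω => blockValue (fun t => c.input ω (o ω + t)) (b ω) (j ω)) := by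
  have hb' : PolyBounded c b := hbb.mono fun ω => Nat.lt_two_pow_self.le
  refine sum (F := fun ω t => c.input ω (o ω + (j ω * b ω + t)) * 2 ^ t) hb hb' ?_
  have h2 : PolyTime (c.round b fun ω t =>
      ∑ j_1 ∈ Finset.range t, c.input ω (o ω + (j ω * b ω + j_1)) * 2 ^ j_1)
      (fun z => o z.1.1 + (j z.1.1 * b z.1.1 + z.1.2)) :=
    ((ho.add ((hj.mul hb hb'))).round _ _ |>.add (index _ _)).congr fun z => by ring
  refine h2.load.mul ((const 2).pow (index _ _) (.const 2) (hb'.index _)) ?_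
  exact (hbb.round _ _).mono fun z => Nat.pow_le_pow_right (by norm_num) z.2.le

theorem powMod {x j p : c.Ω → ℕ} (hx : PolyTime c x) (hj : PolyTime c j) (hp : PolyTime c p)
    (hxb : PolyBounded c x) (hjb : PolyBounded c j) (hpb : PolyBounded c p)
    (hp0 : ∀ ω, 0 < p ω) : PolyTime c (fun ω => x ω ^ j ω % p ω) := by
  refine iterate (iter := fun ω t => x ω ^ t % p ω) hj hjb
    (((const 1).mod hp (.const 1)).congr fun ω => by simp) ?_
  refine (((accumulator _ _).mul (hx.round _ _) (hxb.round _ _)).mod (hp.round _ _) ?_).congr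
    fun z => ?_
  · exact ((hpb.round _ _).mul (hxb.round _ _)).mono fun z =>
      Nat.mul_le_mul_right _ (Nat.mod_lt _ (hp0 _)).le
  · simp [pow_succ]

theorem polyValue {o b d p x : c.Ω → ℕ} (ho : PolyTime c o) (hb : PolyTime c b)
    (hd : PolyTime c d) (hp : PolyTime c p) (hx : PolyTime c x)
    (hbb : PolyBounded c fun ω => 2 ^ b ω) (hdb : PolyBounded c d) (hpb : PolyBounded c p)
    (hxb : PolyBounded c x) (hp0 : ∀ ω, 0 < p ω) (hbit : ∀ ω i, c.input ω i ≤ 1) :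
    PolyTime c (fun ω =>
      polyValue (p ω) (d ω) (b ω) (fun t => c.input ω (o ω + t)) (x ω)) := by
  have h : PolyTime c (fun ω => ∑ j ∈ Finset.range (d ω),
      _root_.blockValue (fun t => c.input ω (o ω + t)) (b ω) j * (x ω ^ j % p ω)) := by
    refine sum hd hdb ?_
    refine (blockValue (ho.round _ _) (hb.round _ _) (index _ _) (hbb.round _ _)).mul
      (powMod (hx.round _ _) (index _ _) (hp.round _ _) (hxb.round _ _) (hdb.index _)
        (hpb.round _ _) fun z => hp0 _) ?_
    exact (hpb.round _ _).mono fun z => (Nat.mod_lt _ (hp0 _)).le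
  refine (h.mod hp ?_).congr fun ω => ?_
  · refine (hdb.mul (hbb.mul hpb)).mono fun ω => ?_
    refine (Finset.sum_le_card_nsmul _ _ (2 ^ b ω * p ω) fun j _ => ?_).trans (by simp)
    exact Nat.mul_le_mul (blockValue_lt (fun i => hbit _ _) _ _).le (Nat.mod_lt _ (hp0 _)).le
  · rw [_root_.polyValue, Finset.sum_nat_mod]
    conv_rhs => rw [Finset.sum_nat_mod]
    simp

section Level

variable {e q o x : c.Ω → ℕ} (he : PolyTime c e) (hq : PolyTime c q) (ho : PolyTime c o)
  (hx : PolyTime c x) (heb : PolyBounded c fun ω => 2 ^ 2 ^ e ω) (hqb : PolyBounded c q)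
  (hxb : PolyBounded c x) (hbit : ∀ ω i, c.input ω i ≤ 1)

include he heb in
theorem twoPow_twoPow : PolyTime c (fun ω => 2 ^ 2 ^ e ω) := by
  have h1 : PolyBounded c (fun ω => 2 ^ e ω) := heb.mono fun ω => Nat.lt_two_pow_self.le
  have h2 : PolyBounded c e := h1.mono fun ω => Nat.lt_two_pow_self.le
  exact (const 2).pow ((const 2).pow he (.const 2) h2) (.const 2) h1

include he hq ho hx heb hqb hxb hbit in
theorem levelValue : PolyTime c (fun ω => _root_.polyValue (_root_.fieldSize (2 ^ 2 ^ e ω))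
    (2 * q ω) (2 ^ (e ω + 1)) (fun t => c.input ω (o ω + t)) (x ω)) := by
  have h1 : PolyBounded c (fun ω => 2 ^ e ω) := heb.mono fun ω => Nat.lt_two_pow_self.le
  have h2 : PolyBounded c e := h1.mono fun ω => Nat.lt_two_pow_self.le
  refine polyValue ho ((const 2).pow (he.add (const 1)) (.const 2) (h2.add (.const 1)))
    ((const 2).mul hq hqb) ((twoPow_twoPow he heb).fieldSize heb) hx ?_ ((PolyBounded.const 2).mul hqb)
    (((PolyBounded.const 2).mul heb).mono fun ω => fieldSize_le _) hxb
    (fun ω => (Nat.two_pow_pos _).trans_le (le_fieldSize _)) hbit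
  exact (heb.mul heb).mono fun ω => by rw [← pow_add, pow_succ, mul_two]

include he hq ho hx heb hqb hxb hbit in
theorem levelBit : PolyTime c (fun ω => levelBit (e ω) (q ω)
    (fun t => c.input ω (o ω + t)) (x ω)) := by
  have h1 : PolyBounded c (fun ω => 2 ^ e ω) := heb.mono fun ω => Nat.lt_two_pow_self.le
  have h2 : PolyBounded c e := h1.mono fun ω => Nat.lt_two_pow_self.le
  have h3 : PolyTime c (fun ω => o ω + 2 * q ω * 2 ^ (e ω + 1)) :=
    ho.add (((const 2).mul hq hqb).mul ((const 2).pow (he.add (const 1)) (.const 2)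
      (h2.add (.const 1))) (((PolyBounded.const 2).mul h1).mono fun ω => by rw [pow_succ']))
  refine ((levelValue he hq h3 hx heb hqb hxb hbit).mod (const 2) ?_).congr fun ω => ?_
  · exact ((PolyBounded.const 2).mul heb).mono fun ω => ((Nat.mod_lt _
      ((Nat.two_pow_pos _).trans_le (le_fieldSize _))).le.trans (fieldSize_le _))
  · simp only [_root_.levelBit, add_assoc]

include he hq ho hx heb hqb hxb hbit in
theorem levelHash : PolyTime c (fun ω => levelHash (e ω) (q ω)
    (fun t => c.input ω (o ω + t)) (x ω)) := by
  refine ((levelValue he hq ho hx heb hqb hxb hbit).mod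
    (twoPow_twoPow (he.sub (const 1)) ?_) ?_)
  · exact heb.mono fun ω => Nat.pow_le_pow_right (by norm_num)
      (Nat.pow_le_pow_right (by norm_num) (Nat.sub_le _ _))
  · exact ((PolyBounded.const 2).mul heb).mono fun ω => ((Nat.mod_lt _
      ((Nat.two_pow_pos _).trans_le (le_fieldSize _))).le.trans (fieldSize_le _))

end Level

end PolyTime

theorem walk_lt (e q : ℕ) (Y : ℕ → ℕ) {i : ℕ} (hi : i < 2 ^ 2 ^ e) (l : ℕ) :
    walk e q Y i l < 2 ^ 2 ^ e := by
  cases l with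
  | zero => exact hi
  | succ l =>
    refine (Nat.mod_lt _ (Nat.two_pow_pos _)).trans_le (Nat.pow_le_pow_right (by norm_num)
      (Nat.pow_le_pow_right (by norm_num) (by omega)))

theorem le_two_pow_two_pow_topLevel (n : ℕ) : n ≤ 2 ^ 2 ^ topLevel n :=
  (Nat.le_pow_clog (by norm_num) n).trans
    (Nat.pow_le_pow_right (by norm_num) (Nat.le_pow_clog (by norm_num) _))

theorem signExp_le (t e q : ℕ) (Y : ℕ → ℕ) (i : ℕ) : signExp t e q Y i ≤ t := by
  refine (Finset.sum_le_card_nsmul _ _ 1 fun l _ => ?_).trans (by simp)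
  exact Nat.lt_succ_iff.mp (Nat.mod_lt _ two_pos)

namespace PolyTime

variable {c : RamContext} {e q i l : c.Ω → ℕ}

theorem levelSeed (he : PolyTime c e) (hq : PolyTime c q)
    (heb : PolyBounded c fun ω => 2 ^ 2 ^ e ω) (hqb : PolyBounded c q) :
    PolyTime c (fun ω => levelSeed (e ω) (q ω)) := by
  have h1 : PolyBounded c (fun ω => 2 ^ e ω) := heb.mono fun ω => Nat.lt_two_pow_self.le
  have h2 : PolyBounded c e := h1.mono fun ω => Nat.lt_two_pow_self.le
  have h3 : PolyBounded c (fun ω => 2 ^ (e ω + 1)) :=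
    ((PolyBounded.const 2).mul h1).mono fun ω => by rw [pow_succ']
  exact (const 2).mul (((const 2).mul hq hqb).mul ((const 2).pow (he.add (const 1)) (.const 2)
    (h2.add (.const 1))) h3) (((PolyBounded.const 2).mul hqb).mul h3)

theorem walk (hl : PolyTime c l) (he : PolyTime c e) (hq : PolyTime c q) (hi : PolyTime c i)
    (heb : PolyBounded c fun ω => 2 ^ 2 ^ e ω) (hqb : PolyBounded c q)
    (hle : ∀ ω, l ω ≤ e ω) (hib : ∀ ω, i ω < 2 ^ 2 ^ e ω) (hbit : ∀ ω i, c.input ω i ≤ 1) :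
    PolyTime c (fun ω => walk (e ω) (q ω) (c.input ω) (i ω) (l ω)) := by
  have h1 : PolyBounded c (fun ω => 2 ^ e ω) := heb.mono fun ω => Nat.lt_two_pow_self.le
  have h2 : PolyBounded c e := h1.mono fun ω => Nat.lt_two_pow_self.le
  have hlb : PolyBounded c l := h2.mono hle
  refine iterate (iter := fun ω t => _root_.walk (e ω) (q ω) (c.input ω) (i ω) t) hl hlb
    (hi.congr fun ω => rfl) ?_
  have hpow : PolyBounded (c.round l fun ω t => _root_.walk (e ω) (q ω) (c.input ω) (i ω) t)
      (fun z => 2 ^ z.1.2) :=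
    (h1.round _ _).mono fun z => Nat.pow_le_pow_right (by norm_num) (z.2.le.trans (hle _))
  refine levelHash (c := c.round l fun ω t => _root_.walk (e ω) (q ω) (c.input ω) (i ω) t)
    ((he.round _ _).sub (index _ _))
    ((hq.round _ _).mul ((const 2).pow (index _ _) (.const 2) (hlb.index _)) hpow)
    (((levelSeed he hq heb hqb).round _ _).mul (index _ _) (hlb.index _) |>.congr
      fun z => mul_comm _ _) (accumulator _ _)
    ((heb.round _ _).mono fun z => Nat.pow_le_pow_right (by norm_num)
      (Nat.pow_le_pow_right (by norm_num) (Nat.sub_le _ _)))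
    ((hqb.round _ _).mul hpow) ((heb.round _ _).mono fun z => (walk_lt _ _ _ (hib _) _).le)
    fun z => hbit _

theorem signExp (hl : PolyTime c l) (he : PolyTime c e) (hq : PolyTime c q) (hi : PolyTime c i)
    (heb : PolyBounded c fun ω => 2 ^ 2 ^ e ω) (hqb : PolyBounded c q)
    (hle : ∀ ω, l ω ≤ e ω) (hib : ∀ ω, i ω < 2 ^ 2 ^ e ω) (hbit : ∀ ω i, c.input ω i ≤ 1) :
    PolyTime c (fun ω => signExp (l ω) (e ω) (q ω) (c.input ω) (i ω)) := by
  have h1 : PolyBounded c (fun ω => 2 ^ e ω) := heb.mono fun ω => Nat.lt_two_pow_self.le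
  have h2 : PolyBounded c e := h1.mono fun ω => Nat.lt_two_pow_self.le
  have hlb : PolyBounded c l := h2.mono hle
  refine sum (F := fun ω t => _root_.levelBit (e ω - t) (q ω * 2 ^ t) (fun j => c.input ω
    (t * _root_.levelSeed (e ω) (q ω) + j)) (_root_.walk (e ω) (q ω) (c.input ω) (i ω) t))
    hl hlb ?_
  set iter : c.Ω → ℕ → ℕ := _
  change PolyTime (c.round l iter) _
  have hpow : PolyBounded (c.round l iter) (fun z => 2 ^ z.1.2) :=
    (h1.round _ _).mono fun z => Nat.pow_le_pow_right (by norm_num) (z.2.le.trans (hle _))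
  exact levelBit (c := c.round l iter)
    ((he.round _ _).sub (index _ _))
    ((hq.round _ _).mul ((const 2).pow (index _ _) (.const 2) (hlb.index _)) hpow)
    (((levelSeed he hq heb hqb).round _ _).mul (index _ _) (hlb.index _) |>.congr
      fun z => mul_comm _ _)
    (walk (c := c.round l iter) (index _ _) (he.round _ _) (hq.round _ _) (hi.round _ _)
      (heb.round _ _) (hqb.round _ _) (fun z => z.2.le.trans (hle _)) (fun z => hib _)
      (fun z => hbit _))
    ((heb.round _ _).mono fun z => Nat.pow_le_pow_right (by norm_num)
      (Nat.pow_le_pow_right (by norm_num) (Nat.sub_le _ _)))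
    ((hqb.round _ _).mul hpow) ((heb.round _ _).mono fun z => (walk_lt _ _ _ (hib _) _).le)
    fun z => hbit _

end PolyTime

/-- The instances `(n, k, Y, i)` for which the bit `i` of the output is to be computed. -/
def outputContext : RamContext where
  Ω := {z : ℕ × ℕ × (ℕ → ℕ) × ℕ // z.2.1 < z.1 ∧ z.2.2.2 < z.1 ∧ ∀ j, z.2.2.1 j ≤ 1}
  size z := z.1.1
  input z := z.1.2.2.1
  numVars := 3
  env z x := if x = 0 then z.1.1 else if x = 1 then z.1.2.1 else z.1.2.2.2

theorem polyTime_generatorBit :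
    PolyTime outputContext (fun z => generatorBit z.1.1 z.1.2.1 z.1.2.2.1 z.1.2.2.2) := by
  have hn : PolyTime outputContext (fun z => z.1.1) :=
    (PolyTime.envVar (c := outputContext) 0 (by simp [outputContext])).congr
      fun z => by simp [outputContext]
  have hk : PolyTime outputContext (fun z => z.1.2.1) :=
    (PolyTime.envVar (c := outputContext) 1 (by simp [outputContext])).congr
      fun z => by simp [outputContext]
  have hi : PolyTime outputContext (fun z => z.1.2.2.2) :=
    (PolyTime.envVar (c := outputContext) 2 (by simp [outputContext])).congr
      fun z => by simp [outputContext]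
  have hnb : PolyBounded outputContext (fun z => z.1.1) := .size
  have hkb : PolyBounded outputContext (fun z => z.1.2.1) := hnb.mono fun z => z.2.1.le
  have hE : PolyTime outputContext (fun z => topLevel z.1.1) :=
    (hn.clog hnb).clog (hnb.mono fun z => clog_le_self _)
  have hNb : PolyBounded outputContext (fun z => 2 ^ 2 ^ topLevel z.1.1) := by
    have h := ((PolyBounded.const 2).mul hnb).add (.const 1)
    refine ((PolyBounded.const 2).mul (h.mul h)).mono fun z => ?_
    rw [← sq]
    exact two_pow_two_pow_topLevel_le _
  have hKb : PolyBounded outputContext (fun z => 2 ^ topLevel z.1.1) :=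
    hNb.mono fun z => Nat.lt_two_pow_self.le
  have hEb : PolyBounded outputContext (fun z => topLevel z.1.1) :=
    hKb.mono fun z => Nat.lt_two_pow_self.le
  have hK : PolyTime outputContext (fun z => 2 ^ topLevel z.1.1) :=
    (PolyTime.const 2).pow hE (.const 2) hEb
  have hdb : PolyBounded outputContext (fun z => z.1.2.1 / 2 ^ topLevel z.1.1 + 1) :=
    (hkb.add (.const 1)).mono fun z => Nat.add_le_add_right (Nat.div_le_self _ _) 1
  have hq : PolyTime outputContext (fun z => topMoment z.1.1 z.1.2.1) :=
    (((PolyTime.const 4).mul ((hk.div hK hkb).add (.const 1)) hdb).add (.const 8))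
  have hqb : PolyBounded outputContext (fun z => topMoment z.1.1 z.1.2.1) :=
    (((PolyBounded.const 4).mul hdb).add (.const 8))
  have hcnt : PolyTime outputContext (fun z => topLevel z.1.1 - 4) := hE.sub (.const 4)
  have hcntb : PolyBounded outputContext (fun z => topLevel z.1.1 - 4) :=
    hEb.mono fun z => Nat.sub_le _ _
  have h := PolyTime.signExp hcnt hE hq hi hNb hqb (fun z => Nat.sub_le _ _)
    (fun z => z.2.2.1.trans_le (le_two_pow_two_pow_topLevel _)) (fun z i => z.2.2.2 i)
  refine (h.mod (.const 2) (hcntb.mono fun z => ?_)).congr fun z => ?_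
  · exact signExp_le _ _ _ _ _
  · rw [generatorBit, if_pos z.2.1]
    rfl

theorem generatorBit_le_one (n k : ℕ) (Y : ℕ → ℕ) (i : ℕ) : generatorBit n k Y i ≤ 1 := by
  unfold generatorBit
  split_ifs
  · exact Nat.lt_succ_iff.mp (Nat.mod_lt _ two_pos)
  · exact zero_le_one

theorem isOutput_generator {n k : ℕ} {y : Fin (seedLength n k) → Bool} {s : RamState}
    (h : ∀ i < n, s.arr 1 i = generatorBit n k (seedBits y) i) :
    s.IsOutput (generator n k y) := by
  intro i
  rw [h i i.2, generator]
  have := generatorBit_le_one n k (seedBits y) i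
  by_cases h0 : generatorBit n k (seedBits y) i = 0
  · simp [h0]
  · rw [if_neg h0, if_neg (by decide)]
    omega

theorem isExplicitGenerator_generator : IsExplicitGenerator seedLength generator := by
  obtain ⟨P, T, hP⟩ := polyTime_generatorBit
  let body : RamProg := .seq (P id 4) (.seq (.store 1 2 4) (.seq (.const 5 1)
    (.seq (.add 2 2 5) (.sub 3 3 5))))
  refine ⟨.seq (.sub 3 0 1) (.cond 3 (.seq (.add 3 0 2) (.loop 3 body)) (.const 4 0)),
    Polynomial.X * (T + 5) + 10, fun n k y => ?_⟩
  by_cases hk : k < n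
  swap
  · refine ⟨_, _, .seq (.sub _ _ _ _) (.cond_false ?_ (.const _ _ _)), ?_, isOutput_generator ?_⟩
    · simp [RamState.setVar_var, ramInput]; omega
    · simp
    · intro i _
      simp [RamState.setVar_arr, ramInput, generatorBit, hk]
  have key : ∀ r t (σ : RamState), t + r = n → σ.var 0 = n → σ.var 1 = k → σ.var 2 = t →
      σ.var 3 = r → σ.arr 0 = seedBits y →
      (∀ i < t, σ.arr 1 i = generatorBit n k (seedBits y) i) →
      ∃ σ' τ, (RamProg.loop 3 body).Exec σ σ' τ ∧ τ ≤ r * (T.eval n + 5) + 1 ∧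
        ∀ i < n, σ'.arr 1 i = generatorBit n k (seedBits y) i := by
    intro r
    induction r with
    | zero =>
      intro t σ ht _ _ _ h3 _ hout
      exact ⟨σ, 1, RamProg.Exec.loop_stop h3, by simp, fun i hi => hout i (by omega)⟩
    | succ r ih =>
      intro t σ ht h0 h1 h2 h3 ha hout
      obtain ⟨σ1, t1, he1, ht1, ha1, hv1, hr1⟩ := hP id 4 (by
          intro x hx
          exact hx.trans (by decide))
        ⟨(n, k, seedBits y, t), hk, by simp only; omega, fun j => seedBits_le_one y j⟩ σ
        ⟨ha, by
          intro x (hx : x < 3)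
          interval_cases x
          · simpa [outputContext] using h0
          · simpa [outputContext] using h1
          · simpa [outputContext] using h2⟩
      obtain ⟨σ', hexec, h0', h1', h2', h3', ha', hout'⟩ : ∃ σ', body.Exec σ σ' (t1 + 4) ∧
          σ'.var 0 = n ∧ σ'.var 1 = k ∧ σ'.var 2 = t + 1 ∧ σ'.var 3 = r ∧
          σ'.arr 0 = seedBits y ∧
          ∀ i < t + 1, σ'.arr 1 i = generatorBit n k (seedBits y) i := by
        refine ⟨_, .seq he1 (.seq (.store _ _ _ _) (.seq (.const _ _ _) (.seq (.add _ _ _ _)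
          (.sub _ _ _ _)))), ?_, ?_, ?_, ?_, ?_, ?_⟩
        · simp [RamState.setVar_var, RamState.setArr, hv1 0, h0]
        · simp [RamState.setVar_var, RamState.setArr, hv1 1, h1]
        · simp [RamState.setVar_var, RamState.setArr, hv1 2, h2]
        · simp [RamState.setVar_var, RamState.setArr, hv1 3, h3]
        · simp [RamState.setVar_arr, RamState.setArr, ha1, ha]
        · intro i hi
          simp only [RamState.setVar_arr, RamState.setArr, ha1, hv1 2 (by decide), h2, hr1,
            Function.update_self, Function.update_apply]
          split_ifs with hit
          · rw [hit]
          · exact hout i (by omega)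
      obtain ⟨σ2, t2, he2, ht2, hr2⟩ := ih (t + 1) σ' (by omega) h0' h1' h2' h3' ha' hout'
      refine ⟨σ2, _, .loop_step (by rw [h3]; omega) hexec he2, ?_, hr2⟩
      have : t1 ≤ T.eval n := ht1
      rw [add_mul, one_mul]
      omega
  obtain ⟨s', t, he, ht, hout⟩ := key n 0
    (((ramInput n k y).setVar 3 (n - k)).setVar 3 n) (by simp)
    (by simp [RamState.setVar_var, ramInput]) (by simp [RamState.setVar_var, ramInput])
    (by simp [RamState.setVar_var, ramInput]) (by simp [RamState.setVar_var])
    (by funext i; simp [RamState.setVar_arr, ramInput, seedBits]) (by simp)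
  refine ⟨s', 1 + (1 + t + 1), .seq (.sub _ _ _ _) (.cond_true ?_ (.seq ?_ he)), ?_,
    isOutput_generator hout⟩
  · simp [RamState.setVar_var, ramInput]; omega
  · have h := RamProg.Exec.add ((ramInput n k y).setVar 3 (n - k)) 3 0 2
    simpa [RamState.setVar_var, ramInput] using h
  · simp only [Polynomial.eval_add, Polynomial.eval_mul, Polynomial.eval_X, Polynomial.eval_ofNat]
    omega

open scoped BigOperators

/-- Any `d` of the random variables `X · i` are independent and uniform. -/
def KWiseUniform {Ω ι U : Type} [Fintype Ω] [Fintype U] (d : ℕ) (X : Ω → ι → U) : Prop :=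
  ∀ (κ : Type) [Fintype κ] (g : κ → ι) (φ : κ → U → ℝ), g.Injective → Fintype.card κ ≤ d →
    𝔼 ω, ∏ k, φ k (X ω (g k)) = ∏ k, 𝔼 u, φ k u

theorem expect_comp_of_surjective {A B : Type} [AddCommGroup A] [AddCommGroup B] [Fintype A]
    [Fintype B] (f : A →+ B) (hf : Function.Surjective f) (G : B → ℝ) :
    𝔼 a, G (f a) = 𝔼 b, G b := by
  classical
  have hcard : ∀ b, (Finset.univ.filter fun a => f a = b).card =
      (Finset.univ.filter fun a => f a = 0).card := fun b =>
    AddMonoidHom.card_fiber_eq_of_mem_range f (hf b) (hf 0)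
  have h1 : ∑ a, G (f a) = (Finset.univ.filter fun a => f a = 0).card * ∑ b, G b := by
    rw [← Finset.sum_fiberwise (s := Finset.univ) (g := f), Finset.mul_sum]
    refine Finset.sum_congr rfl fun b _ => ?_
    rw [← hcard b, ← nsmul_eq_mul, ← Finset.sum_const]
    exact Finset.sum_congr rfl fun a ha => by rw [(Finset.mem_filter.mp ha).2]
  have h2 : Fintype.card A = (Finset.univ.filter fun a => f a = 0).card * Fintype.card B := by
    rw [← Finset.card_univ, Finset.card_eq_sum_card_fiberwise (f := f) (t := Finset.univ)
      (fun _ _ => by simp), Finset.sum_congr rfl fun b _ => hcard b]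
    simp [mul_comm]
  rw [Fintype.expect_eq_sum_div_card, Fintype.expect_eq_sum_div_card, h1, h2]
  have h0 : ((Finset.univ.filter fun a => f a = 0).card : ℝ) ≠ 0 := by
    have : 0 ∈ Finset.univ.filter fun a => f a = 0 := by simp
    exact_mod_cast (Finset.card_pos.mpr ⟨_, this⟩).ne'
  push_cast
  rw [mul_div_mul_left _ _ h0]

theorem expect_prod_pi {κ U : Type} [Fintype κ] [DecidableEq κ] [Fintype U] (φ : κ → U → ℝ) :
    𝔼 t : κ → U, ∏ k, φ k (t k) = ∏ k, 𝔼 u, φ k u := by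
  simp only [Fintype.expect_eq_sum_div_card, Finset.prod_div_distrib]
  rw [Finset.prod_univ_sum, Fintype.piFinset_univ]
  simp

theorem kWiseUniform_polynomial (p d : ℕ) [Fact p.Prime] {ι : Type} (x : ι → ZMod p)
    (hx : Function.Injective x) :
    KWiseUniform d (fun (c : Fin d → ZMod p) i => ∑ j, c j * x i ^ (j : ℕ)) := by
  classical
  intro κ _ g φ hg hcard
  let f : (Fin d → ZMod p) →+ (κ → ZMod p) :=
    { toFun := fun c k => ∑ j, c j * x (g k) ^ (j : ℕ)
      map_zero' := by ext; simp
      map_add' := fun c c' => by ext; simp [add_mul, Finset.sum_add_distrib] }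
  have hf : Function.Surjective f := by
    intro t
    have hinj : Set.InjOn (fun k => x (g k)) (Finset.univ : Finset κ) := (hx.comp hg).injOn
    let P := Lagrange.interpolate Finset.univ (fun k => x (g k)) t
    have hP : P.degree < d :=
      (Lagrange.degree_interpolate_lt t hinj).trans_le (by exact_mod_cast hcard)
    refine ⟨fun j => P.coeff j, funext fun k => ?_⟩
    have h1 : P.eval (x (g k)) = t k :=
      Lagrange.eval_interpolate_at_node t hinj (Finset.mem_univ k)
    rw [← h1]
    rcases Nat.eq_zero_or_pos d with rfl | hd
    · have : P = 0 := by simpa using hP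
      simp [f, this]
    · have hnat : P.natDegree < d := by
        by_cases h0 : P = 0
        · rwa [h0, Polynomial.natDegree_zero]
        · exact (Polynomial.natDegree_lt_iff_degree_lt h0).mpr hP
      rw [Polynomial.eval_eq_sum_range' hnat, Finset.sum_range]
      rfl
  rw [← expect_prod_pi]
  exact expect_comp_of_surjective f hf fun t => ∏ k, φ k (t k)

/-- A graph without isolated vertices has few colourings that are constant along edges. -/
theorem sq_card_colorings_le {V β : Type} [Fintype V] [Fintype β] [DecidableEq V] [Nonempty β]
    (S : Finset (V → β)) (h : ∀ v, ∃ u, u ≠ v ∧ ∀ c ∈ S, c u = c v) :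
    S.card ^ 2 ≤ Fintype.card β ^ Fintype.card V := by
  classical
  let r : Setoid V :=
    { r := fun u v => ∀ c ∈ S, c u = c v
      iseqv := ⟨fun _ _ _ => rfl, fun h c hc => (h c hc).symm,
        fun h h' c hc => (h c hc).trans (h' c hc)⟩ }
  have h1 : S.card ≤ Fintype.card β ^ Fintype.card (Quotient r) := by
    rw [← Fintype.card_fun, ← Finset.card_univ]
    refine Finset.card_le_card_of_injOn (fun c q => c q.out) (fun _ _ => by simp) ?_
    intro c hc c' hc' heq
    funext v
    have h2 := congrFun heq (Quotient.mk r v)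
    have h3 : r (Quotient.mk r v).out v := Quotient.mk_out v
    rw [← h3 c hc, ← h3 c' hc']
    exact h2
  have h2 : 2 * Fintype.card (Quotient r) ≤ Fintype.card V := by
    rw [← Finset.card_univ (α := V), Finset.card_eq_sum_card_fiberwise (f := Quotient.mk r)
      (t := Finset.univ) (fun _ _ => by simp), mul_comm, ← Finset.card_univ, ← smul_eq_mul]
    refine Finset.card_nsmul_le_sum _ _ _ fun q _ => ?_
    obtain ⟨v, rfl⟩ := Quotient.exists_rep q
    obtain ⟨u, hu, hc⟩ := h v
    refine Finset.one_lt_card.mpr ⟨u, ?_, v, ?_, hu⟩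
    · simp only [Finset.mem_filter, Finset.mem_univ, true_and]
      exact Quotient.sound hc
    · simp
  calc S.card ^ 2 ≤ (Fintype.card β ^ Fintype.card (Quotient r)) ^ 2 := Nat.pow_le_pow_left h1 2
    _ = Fintype.card β ^ (2 * Fintype.card (Quotient r)) := by rw [← pow_mul, mul_comm]
    _ ≤ _ := Nat.pow_le_pow_right Fintype.card_pos h2

theorem sum_prod_image_le {τ ι : Type} [Fintype τ] [DecidableEq τ] [Fintype ι] [DecidableEq ι]
    (P : ι → ℝ) (h0 : ∀ i, 0 ≤ P i) (h1 : ∑ i, P i ≤ 1) :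
    ∑ f : τ → ι, ∏ v ∈ Finset.univ.image f, P v ≤
      3 * (Fintype.card τ : ℝ) ^ Fintype.card τ := by
  have hV : ∀ V : Finset ι, ∑ f : τ → ι with Finset.univ.image f = V,
      ∏ v ∈ Finset.univ.image f, P v ≤ (Fintype.card τ : ℝ) ^ Fintype.card τ * ∏ v ∈ V, P v := by
    intro V
    rw [Finset.sum_congr rfl (g := fun _ => ∏ v ∈ V, P v)
      (fun f hf => by rw [(Finset.mem_filter.mp hf).2]), Finset.sum_const, nsmul_eq_mul]
    refine mul_le_mul_of_nonneg_right ?_ (Finset.prod_nonneg fun i _ => h0 i)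
    rcases Finset.eq_empty_or_nonempty (Finset.univ.filter fun f : τ → ι =>
      Finset.univ.image f = V) with he | ⟨f, hf⟩
    · rw [he]; simp
    · have hc : V.card ≤ Fintype.card τ := by
        rw [← (Finset.mem_filter.mp hf).2]
        exact Finset.card_image_le
      have hsub : (Finset.univ.filter fun f : τ → ι => Finset.univ.image f = V) ⊆
          Fintype.piFinset fun _ => V := by
        intro f hf
        rw [Fintype.mem_piFinset]
        intro a
        rw [← (Finset.mem_filter.mp hf).2]
        exact Finset.mem_image_of_mem _ (Finset.mem_univ a)
      have := (Finset.card_le_card hsub).trans (by simp : _ ≤ V.card ^ Fintype.card τ)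
      exact_mod_cast this.trans (Nat.pow_le_pow_left hc _)
  rw [← Finset.sum_fiberwise (s := Finset.univ) (g := fun f : τ → ι => Finset.univ.image f)]
  calc _ ≤ ∑ V : Finset ι, (Fintype.card τ : ℝ) ^ Fintype.card τ * ∏ v ∈ V, P v :=
        Finset.sum_le_sum fun V _ => hV V
    _ = (Fintype.card τ : ℝ) ^ Fintype.card τ * ∏ i, (1 + P i) := by
        rw [← Finset.mul_sum, Finset.prod_one_add, Finset.powerset_univ]
    _ ≤ (Fintype.card τ : ℝ) ^ Fintype.card τ * 3 := by
        refine mul_le_mul_of_nonneg_left ?_ (by positivity)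
        calc ∏ i, (1 + P i) ≤ ∏ i, Real.exp (P i) :=
              Finset.prod_le_prod (fun i _ => by linarith [h0 i])
                fun i _ => by linarith [Real.add_one_le_exp (P i)]
          _ = Real.exp (∑ i, P i) := (Real.exp_sum _ _).symm
          _ ≤ Real.exp 1 := Real.exp_le_exp.mpr h1
          _ ≤ 3 := Real.exp_one_lt_three.le
    _ = _ := mul_comm _ _

section Moments

variable {Ω Ω' ι U U' β : Type} [Fintype Ω] [Fintype Ω'] [Fintype ι] [Fintype U] [Fintype U']
  [Fintype β] [DecidableEq ι] [DecidableEq β]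

omit [Fintype ι] in
theorem expect_collision_le [Nonempty β] {σ : Type} [Fintype σ] [DecidableEq σ] {d : ℕ}
    {X : Ω → ι → U} (hX : KWiseUniform d X) (b : U → β)
    (hb : ∀ j, 𝔼 u, (if b u = j then 1 else 0 : ℝ) ≤ 2 / Fintype.card β) (f : σ × Bool → ι)
    (hcard : (Finset.univ.image f).card ≤ d) (hf : ∀ s, f (s, false) ≠ f (s, true)) :
    𝔼 ω, (if ∀ s, b (X ω (f (s, false))) = b (X ω (f (s, true))) then 1 else 0 : ℝ) ≤
      (2 / √(Fintype.card β)) ^ (Finset.univ.image f).card := by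
  set V := Finset.univ.image f with hVdef
  have hmem : ∀ t, f t ∈ V := fun t => Finset.mem_image_of_mem _ (Finset.mem_univ t)
  let S : Finset (V → β) := Finset.univ.filter fun c =>
    ∀ s, c ⟨f (s, false), hmem _⟩ = c ⟨f (s, true), hmem _⟩
  have hS : S.card ^ 2 ≤ Fintype.card β ^ V.card := by
    have h := sq_card_colorings_le S (fun v => ?_)
    · simpa using h
    · obtain ⟨⟨s, i⟩, -, hv⟩ := Finset.mem_image.mp v.2
      cases i with
      | false =>
        refine ⟨⟨f (s, true), hmem _⟩, fun h => hf s ?_, fun c hc => ?_⟩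
        · rw [hv, ← h]
        · have hv' : v = ⟨f (s, false), hmem _⟩ := Subtype.ext hv.symm
          rw [hv']
          exact ((Finset.mem_filter.mp hc).2 s).symm
      | true =>
        refine ⟨⟨f (s, false), hmem _⟩, fun h => hf s ?_, fun c hc => ?_⟩
        · rw [hv, ← h]
        · have hv' : v = ⟨f (s, true), hmem _⟩ := Subtype.ext hv.symm
          rw [hv']
          exact (Finset.mem_filter.mp hc).2 s
  have hm : (0 : ℝ) < Fintype.card β := by exact_mod_cast Fintype.card_pos
  have hS' : (S.card : ℝ) ≤ √(Fintype.card β) ^ V.card := by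
    refine (sq_le_sq₀ (by positivity) (by positivity)).mp ?_
    rw [← pow_mul, mul_comm, pow_mul, Real.sq_sqrt hm.le]
    exact_mod_cast hS
  calc _ ≤ 𝔼 ω, ∑ c ∈ S, ∏ v : V, (if b (X ω v) = c v then 1 else 0 : ℝ) := by
        refine Finset.expect_le_expect fun ω _ => ?_
        have h0 : ∀ c ∈ S, (0 : ℝ) ≤ ∏ v : V, (if b (X ω v) = c v then 1 else 0 : ℝ) :=
          fun c _ => Finset.prod_nonneg fun v _ => by split_ifs <;> simp
        split_ifs with h
        · refine le_trans ?_ (Finset.single_le_sum h0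
            (show (fun v : V => b (X ω v)) ∈ S from Finset.mem_filter.mpr ⟨Finset.mem_univ _, h⟩))
          simp
        · exact Finset.sum_nonneg h0
    _ = ∑ c ∈ S, ∏ v : V, 𝔼 u, (if b u = c v then 1 else 0 : ℝ) := by
        rw [Finset.expect_sum_comm]
        refine Finset.sum_congr rfl fun c _ => ?_
        exact hX V (fun v => v) (fun v u => if b u = c v then 1 else 0) Subtype.val_injective
          (by rwa [Fintype.card_coe])
    _ ≤ ∑ c ∈ S, (2 / (Fintype.card β : ℝ)) ^ V.card := by
        refine Finset.sum_le_sum fun c _ => ?_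
        refine (Finset.prod_le_prod (fun v _ => Finset.expect_nonneg fun u _ => ?_)
          (fun v _ => hb (c v))).trans (by simp [div_pow])
        split_ifs <;> simp
    _ = S.card * (2 / (Fintype.card β : ℝ)) ^ V.card := by simp
    _ ≤ √(Fintype.card β) ^ V.card * (2 / (Fintype.card β : ℝ)) ^ V.card := by gcongr
    _ = _ := by
        rw [← mul_pow]
        congr 1
        nth_rw 2 [← Real.mul_self_sqrt hm.le]
        have : √(Fintype.card β : ℝ) ≠ 0 := (Real.sqrt_pos.mpr hm).ne'
        field_simp

omit [Fintype ι] in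
theorem abs_expect_prod_le {τ : Type} [Fintype τ] [DecidableEq τ] {d : ℕ} {X : Ω → ι → U}
    (hX : KWiseUniform d X) (ζ : U → ℝ) (hζ0 : 𝔼 u, ζ u = 0) (hζ : ∀ u, |ζ u| ≤ 2) [Nonempty U]
    (f : τ → ι) (hcard : (Finset.univ.image f).card ≤ d) :
    |𝔼 ω, ∏ t, ζ (X ω (f t))| ≤ ∏ v ∈ Finset.univ.image f,
      if (Finset.univ.filter fun t => f t = v).card = 1 then 0
      else (2 : ℝ) ^ (Finset.univ.filter fun t => f t = v).card := by
  have h1 : 𝔼 ω, ∏ t, ζ (X ω (f t)) = ∏ v ∈ Finset.univ.image f,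
      𝔼 u, ζ u ^ (Finset.univ.filter fun t => f t = v).card := by
    have h := hX (Finset.univ.image f) (fun v => v)
      (fun v u => ζ u ^ (Finset.univ.filter fun t => f t = v).card) Subtype.val_injective
      (by rwa [Fintype.card_coe])
    rw [Finset.prod_coe_sort (Finset.univ.image f)
      (fun v => 𝔼 u, ζ u ^ (Finset.univ.filter fun t => f t = v).card)] at h
    rw [← h]
    refine Finset.expect_congr rfl fun ω _ => ?_
    rw [Finset.prod_coe_sort (Finset.univ.image f)
      (fun v => ζ (X ω v) ^ (Finset.univ.filter fun t => f t = v).card),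
      Finset.prod_comp (fun v => ζ (X ω v)) f]
  rw [h1, Finset.abs_prod]
  refine Finset.prod_le_prod (fun _ _ => abs_nonneg _) fun v _ => ?_
  split_ifs with h
  · simp [h, hζ0]
  · refine (Finset.abs_expect_le _ _).trans (Finset.expect_le Finset.univ_nonempty fun u _ => ?_)
    rw [abs_pow]
    exact pow_le_pow_left₀ (abs_nonneg _) (hζ u) _

omit [Fintype ι] in
theorem weight_term_le {τ : Type} [Fintype τ] [DecidableEq τ] {w : ι → ℝ} {θ : ℝ}
    (hw : ∀ i, |w i| ≤ θ) (f : τ → ι) :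
    (∏ t, |w (f t)|) * (2 * θ ^ 2) ^ (Finset.univ.image f).card *
      (∏ v ∈ Finset.univ.image f,
        if (Finset.univ.filter fun t => f t = v).card = 1 then 0
        else (2 : ℝ) ^ (Finset.univ.filter fun t => f t = v).card) ≤
      (4 * θ) ^ Fintype.card τ * ∏ v ∈ Finset.univ.image f, w v ^ 2 := by
  have hcard : Fintype.card τ =
      ∑ v ∈ Finset.univ.image f, (Finset.univ.filter fun t => f t = v).card := by
    rw [← Finset.card_univ]
    exact Finset.card_eq_sum_card_image f _
  rw [Finset.prod_comp (fun v => |w v|) f, ← Finset.prod_const, hcard,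
    ← Finset.prod_pow_eq_pow_sum, ← Finset.prod_mul_distrib, ← Finset.prod_mul_distrib,
    ← Finset.prod_mul_distrib]
  refine Finset.prod_le_prod (fun v _ => ?_) fun v hv => ?_
  · split_ifs <;> positivity
  · have hθ : 0 ≤ θ := (abs_nonneg _).trans (hw v)
    set k := (Finset.univ.filter fun t => f t = v).card with hk
    have hk0 : k ≠ 0 := by
      obtain ⟨t, -, ht⟩ := Finset.mem_image.mp hv
      exact (Finset.card_pos.mpr ⟨t, by simp [ht]⟩).ne'
    split_ifs with h1
    · rw [mul_zero]; positivity
    · obtain ⟨l, hl⟩ : ∃ l, k = l + 2 := ⟨k - 2, by omega⟩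
      have h2 : |w v| ^ k ≤ w v ^ 2 * θ ^ l := by
        rw [hl, pow_add, sq_abs, mul_comm]
        exact mul_le_mul_of_nonneg_left (pow_le_pow_left₀ (abs_nonneg _) (hw v) l) (sq_nonneg _)
      have h3 : (2 : ℝ) * 2 ^ k ≤ 4 ^ k := by
        rw [← pow_succ', show (4 : ℝ) = 2 ^ 2 by norm_num, ← pow_mul]
        exact pow_le_pow_right₀ (by norm_num) (by omega)
      calc |w v| ^ k * (2 * θ ^ 2) * 2 ^ k ≤ w v ^ 2 * θ ^ l * (2 * θ ^ 2) * 2 ^ k := by gcongr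
        _ = w v ^ 2 * θ ^ k * (2 * 2 ^ k) := by rw [hl, pow_add θ]; ring
        _ ≤ w v ^ 2 * θ ^ k * 4 ^ k := by gcongr
        _ = _ := by rw [mul_pow]; ring

/-- The contribution of pairs of distinct indices in the same bucket. -/
def crossTerm (w : ι → ℝ) (h : ι → β) (z : ι → ℝ) : ℝ :=
  ∑ i, ∑ j, if i ≠ j ∧ h i = h j then (w i * z i) * (w j * z j) else 0

omit [Fintype β] in
theorem crossTerm_pow (w : ι → ℝ) (h : ι → β) (z : ι → ℝ) (q : ℕ) :
    crossTerm w h z ^ q = ∑ f : Fin q × Bool → ι,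
      if ∀ s, f (s, false) ≠ f (s, true) then
        (∏ t, w (f t)) * (if ∀ s, h (f (s, false)) = h (f (s, true)) then 1 else 0) *
          ∏ t, z (f t)
      else 0 := by
  have h1 : crossTerm w h z = ∑ x : Bool → ι,
      (if x false ≠ x true then 1 else 0) * (if h (x false) = h (x true) then 1 else 0) *
        ∏ b, (w (x b) * z (x b)) := by
    rw [crossTerm, ← Fintype.sum_prod_type', ← (Equiv.boolArrowEquivProd ι).sum_comp]
    refine Finset.sum_congr rfl fun x _ => ?_
    simp only [Equiv.boolArrowEquivProd, Equiv.coe_fn_mk, Fintype.prod_bool]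
    by_cases hx : x false = x true
    · simp [hx]
    · by_cases hh : h (x false) = h (x true)
      · simp [hx, hh, mul_comm]
      · simp [hh]
  rw [h1, Fintype.sum_pow, ← (Equiv.curry (Fin q) Bool ι).sum_comp]
  refine Finset.sum_congr rfl fun f _ => ?_
  simp only [Finset.prod_mul_distrib, Fintype.prod_ite_zero, Finset.prod_const_one,
    Equiv.curry_apply, Function.curry, Fintype.prod_prod_type]
  split_ifs <;> simp

/-- High moments of the cross term for bounded weights. -/
theorem expect_crossTerm_pow_le [Nonempty β] [Nonempty U'] {q d : ℕ} (hqd : 2 * q ≤ d)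
    {X : Ω → ι → U} (hX : KWiseUniform d X) {X' : Ω' → ι → U'} (hX' : KWiseUniform d X')
    (b : U → β) (hb : ∀ j, 𝔼 u, (if b u = j then 1 else 0 : ℝ) ≤ 2 / Fintype.card β)
    (ζ : U' → ℝ) (hζ0 : 𝔼 u, ζ u = 0) (hζ : ∀ u, |ζ u| ≤ 2)
    {w : ι → ℝ} (hw1 : ∑ i, w i ^ 2 ≤ 1) (hw : ∀ i, w i ^ 2 ≤ 1 / √(Fintype.card β)) :
    𝔼 ω, 𝔼 ω', crossTerm w (fun i => b (X ω i)) (fun i => ζ (X' ω' i)) ^ q ≤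
      3 * (16 / √(Fintype.card β)) ^ q * (2 * q : ℝ) ^ (2 * q) := by
  set ρ := √(Fintype.card β : ℝ) with hρ
  have hρ0 : 0 < ρ := Real.sqrt_pos.mpr (by exact_mod_cast Fintype.card_pos)
  set θ := √(1 / ρ) with hθ
  have hθ2 : θ ^ 2 = 1 / ρ := Real.sq_sqrt (by positivity)
  have hwθ : ∀ i, |w i| ≤ θ := fun i => Real.abs_le_sqrt (hw i)
  have hcard : ∀ f : Fin q × Bool → ι, (Finset.univ.image f).card ≤ d := fun f =>
    Finset.card_image_le.trans (by simpa [mul_comm] using hqd)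
  have hterm : ∀ f : Fin q × Bool → ι, 𝔼 ω, 𝔼 ω',
      (if ∀ s, f (s, false) ≠ f (s, true) then
        (∏ t, w (f t)) * (if ∀ s, b (X ω (f (s, false))) = b (X ω (f (s, true))) then 1 else 0) *
          ∏ t, ζ (X' ω' (f t))
      else 0) ≤ (16 / ρ) ^ q * ∏ v ∈ Finset.univ.image f, w v ^ 2 := by
    intro f
    by_cases hf : ∀ s, f (s, false) ≠ f (s, true)
    swap
    · simp only [if_neg hf, Finset.expect_const_zero]
      exact mul_nonneg (by positivity) (Finset.prod_nonneg fun v _ => sq_nonneg _)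
    simp only [if_pos hf]
    simp only [← Finset.mul_expect, ← Finset.expect_mul]
    have h1 := expect_collision_le hX b hb f (hcard f) hf
    have h2 := abs_expect_prod_le hX' ζ hζ0 hζ f (hcard f)
    have h3 := weight_term_le hwθ f
    have h4 : (0 : ℝ) ≤ 𝔼 ω, (if ∀ s, b (X ω (f (s, false))) = b (X ω (f (s, true))) then 1
      else 0 : ℝ) := Finset.expect_nonneg fun ω _ => by split_ifs <;> simp
    have h5 : 2 * θ ^ 2 = 2 / ρ := by rw [hθ2]; ring
    have h6 : (4 * θ) ^ Fintype.card (Fin q × Bool) = (16 / ρ) ^ q := by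
      rw [Fintype.card_prod, Fintype.card_fin, Fintype.card_bool, mul_comm q, pow_mul, mul_pow,
        hθ2]
      congr 1; ring
    rw [← h6]
    refine le_trans ?_ h3
    refine (le_abs_self _).trans ?_
    rw [abs_mul, abs_mul, Finset.abs_prod, abs_of_nonneg h4, h5]
    gcongr
    refine le_trans (le_of_eq ?_) h1
    congr!
  simp only [crossTerm_pow]
  have hswap : 𝔼 ω, 𝔼 ω', (∑ f : Fin q × Bool → ι,
      if ∀ s, f (s, false) ≠ f (s, true) then
        (∏ t, w (f t)) * (if ∀ s, b (X ω (f (s, false))) = b (X ω (f (s, true))) then 1 else 0) *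
          ∏ t, ζ (X' ω' (f t))
      else 0) = ∑ f : Fin q × Bool → ι, 𝔼 ω, 𝔼 ω',
      (if ∀ s, f (s, false) ≠ f (s, true) then
        (∏ t, w (f t)) * (if ∀ s, b (X ω (f (s, false))) = b (X ω (f (s, true))) then 1 else 0) *
          ∏ t, ζ (X' ω' (f t))
      else 0) := by
    rw [← Finset.expect_sum_comm]
    exact Finset.expect_congr rfl fun ω _ => Finset.expect_sum_comm _ _ _
  rw [hswap]
  calc _ ≤ ∑ f : Fin q × Bool → ι, (16 / ρ) ^ q * ∏ v ∈ Finset.univ.image f, w v ^ 2 :=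
        Finset.sum_le_sum fun f _ => hterm f
    _ ≤ (16 / ρ) ^ q * (3 * (2 * q : ℝ) ^ (2 * q)) := by
        rw [← Finset.mul_sum]
        refine mul_le_mul_of_nonneg_left ?_ (by positivity)
        have h := sum_prod_image_le (τ := Fin q × Bool) (fun i => w i ^ 2)
          (fun i => sq_nonneg _) hw1
        simpa [mul_comm] using h
    _ = _ := by ring

end Moments

/-- The sum of the weights in a bucket. -/
def bucketSum {ι β : Type} [Fintype ι] [DecidableEq β] (h : ι → β) (y : ι → ℝ) (j : β) : ℝ :=
  ∑ i with h i = j, y i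

section Deterministic

variable {ι β : Type} [Fintype ι] [Fintype β] [DecidableEq ι] [DecidableEq β]

theorem sum_bucketSum_sq (w z : ι → ℝ) (h : ι → β) :
    ∑ j, bucketSum h (fun i => w i * z i) j ^ 2 =
      ∑ i, (w i * z i) ^ 2 + crossTerm w h z := by
  have h1 : ∀ j, bucketSum h (fun i => w i * z i) j ^ 2 =
      ∑ i with h i = j, ∑ k, if h i = h k then (w i * z i) * (w k * z k) else 0 := by
    intro j
    rw [bucketSum, sq, Finset.sum_mul_sum]
    refine Finset.sum_congr rfl fun i hi => ?_
    rw [(Finset.mem_filter.mp hi).2, Finset.sum_filter]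
    simp only [eq_comm]
  rw [Finset.sum_congr rfl fun j _ => h1 j, Finset.sum_fiberwise, crossTerm,
    ← Finset.sum_add_distrib]
  refine Finset.sum_congr rfl fun i _ => ?_
  rw [← Finset.add_sum_erase _ _ (Finset.mem_univ i),
    ← Finset.add_sum_erase Finset.univ (fun j => if i ≠ j ∧ h i = h j then _ else _)
      (Finset.mem_univ i)]
  simp only [if_true, ne_eq, not_true, false_and, if_false, zero_add, sq]
  congr 1
  refine Finset.sum_congr rfl fun k hk => ?_
  simp [(Finset.ne_of_mem_erase hk).symm]

omit [DecidableEq ι] in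
theorem sum_bucketSum_sq_le_card_mul (h : ι → β) (y : ι → ℝ) (n : ℕ)
    (S : Finset ι) (hy : ∀ i ∉ S, y i = 0) (hn : ∀ j, (S.filter fun i => h i = j).card ≤ n) :
    ∑ j, bucketSum h y j ^ 2 ≤ n * ∑ i, y i ^ 2 := by
  rw [← Finset.sum_fiberwise (s := Finset.univ) (g := h) (f := fun i => y i ^ 2), Finset.mul_sum]
  refine Finset.sum_le_sum fun j _ => ?_
  have h1 : bucketSum h y j = ∑ i ∈ S.filter fun i => h i = j, y i := by
    refine (Finset.sum_subset (fun i hi => ?_) fun i hi hi' => ?_).symm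
    · simpa using (Finset.mem_filter.mp hi).2
    · exact hy i fun hS => hi' (Finset.mem_filter.mpr ⟨hS, (Finset.mem_filter.mp hi).2⟩)
  rw [h1]
  refine sq_sum_le_card_mul_sum_sq.trans (mul_le_mul (by exact_mod_cast hn j) ?_
    (Finset.sum_nonneg fun i _ => sq_nonneg _) (Nat.cast_nonneg n))
  refine Finset.sum_le_sum_of_subset_of_nonneg (fun i hi => ?_) fun i _ _ => sq_nonneg _
  simpa using (Finset.mem_filter.mp hi).2

omit [Fintype β] [DecidableEq ι] in
theorem bucketSum_add (h : ι → β) (y y' : ι → ℝ) (j : β) :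
    bucketSum h (fun i => y i + y' i) j = bucketSum h y j + bucketSum h y' j :=
  Finset.sum_add_distrib

/-- If the heavy weights are spread well and the cross term of the light weights is small, then the
bucket sums are small. -/
theorem sum_bucketSum_sq_le {w z : ι → ℝ} {h : ι → β} {H : Finset ι} {T : ℕ} {μ τ : ℝ}
    (hw : ∑ i, w i ^ 2 ≤ 1) (hz : ∀ i, |z i| ≤ 1) (hμ : |μ| ≤ 1) (hμ' : Fintype.card ι * μ ^ 2 ≤ 1)
    (hH : ∀ j, (H.filter fun i => h i = j).card ≤ T)
    (hτ : crossTerm (fun i => if i ∈ H then 0 else w i) h (fun i => z i - μ) ≤ τ) :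
    ∑ j, bucketSum h (fun i => w i * z i) j ^ 2 ≤ 3 * (T + 5 + τ) := by
  set wl : ι → ℝ := fun i => if i ∈ H then 0 else w i with hwl
  have hwlw : ∀ i, wl i ^ 2 ≤ w i ^ 2 := fun i => by
    simp only [hwl]; split_ifs
    · simpa using sq_nonneg (w i)
    · exact le_rfl
  have hwl1 : ∑ i, wl i ^ 2 ≤ 1 := (Finset.sum_le_sum fun i _ => hwlw i).trans hw
  let a : ι → ℝ := fun i => if i ∈ H then w i * z i else 0
  have hsplit : ∀ j, bucketSum h (fun i => w i * z i) j =
      bucketSum h a j + bucketSum h (fun i => wl i * (z i - μ)) j +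
        bucketSum h (fun i => wl i * μ) j := by
    intro j
    rw [← bucketSum_add, ← bucketSum_add]
    congr 1
    funext i
    simp only [a, hwl]
    split_ifs <;> ring
  have ha : ∑ j, bucketSum h a j ^ 2 ≤ T := by
    refine (sum_bucketSum_sq_le_card_mul h a T H (fun i hi => if_neg hi) hH).trans ?_
    have : ∑ i, a i ^ 2 ≤ 1 := by
      refine (Finset.sum_le_sum fun i _ => ?_).trans hw
      simp only [a]
      split_ifs
      · rw [mul_pow]
        have := (sq_le_one_iff_abs_le_one (z i)).mpr (hz i)
        nlinarith [sq_nonneg (w i)]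
      · simpa using sq_nonneg (w i)
    exact mul_le_of_le_one_right (Nat.cast_nonneg T) this
  have hb : ∑ j, bucketSum h (fun i => wl i * (z i - μ)) j ^ 2 ≤ 4 + τ := by
    rw [sum_bucketSum_sq]
    refine add_le_add ?_ hτ
    calc ∑ i, (wl i * (z i - μ)) ^ 2 ≤ ∑ i, wl i ^ 2 * 4 := by
          refine Finset.sum_le_sum fun i _ => ?_
          rw [mul_pow]
          refine mul_le_mul_of_nonneg_left ?_ (sq_nonneg _)
          have h2 : |z i - μ| ≤ 2 := (abs_sub _ _).trans (by linarith [hz i])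
          have := sq_le_sq' (abs_le.mp h2).1 (abs_le.mp h2).2
          linarith
      _ ≤ 4 := by rw [← Finset.sum_mul]; linarith
  have hc : ∑ j, bucketSum h (fun i => wl i * μ) j ^ 2 ≤ 1 := by
    refine (sum_bucketSum_sq_le_card_mul h _ (Fintype.card ι) Finset.univ (by simp)
      fun j => Finset.card_le_univ _).trans ?_
    simp only [mul_pow]
    rw [← Finset.sum_mul]
    nlinarith [Finset.sum_nonneg fun (i : ι) (_ : i ∈ Finset.univ) => sq_nonneg (wl i)]
  calc ∑ j, bucketSum h (fun i => w i * z i) j ^ 2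
      ≤ ∑ j, 3 * (bucketSum h a j ^ 2 + bucketSum h (fun i => wl i * (z i - μ)) j ^ 2 +
        bucketSum h (fun i => wl i * μ) j ^ 2) := by
        refine Finset.sum_le_sum fun j _ => ?_
        rw [hsplit]
        nlinarith [sq_nonneg (bucketSum h a j - bucketSum h (fun i => wl i * (z i - μ)) j),
          sq_nonneg (bucketSum h a j - bucketSum h (fun i => wl i * μ) j),
          sq_nonneg (bucketSum h (fun i => wl i * (z i - μ)) j -
            bucketSum h (fun i => wl i * μ) j)]
    _ ≤ _ := by
        rw [← Finset.mul_sum, Finset.sum_add_distrib, Finset.sum_add_distrib]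
        linarith

end Deterministic

section Level

variable {Ω Ω' ι U U' β : Type} [Fintype Ω] [Fintype Ω'] [Fintype ι] [Fintype U] [Fintype U']
  [Fintype β] [DecidableEq ι] [DecidableEq β]

open Classical in
omit [Fintype ι] [DecidableEq ι] in
theorem expect_load_le {T d : ℕ} (hT : T ≤ d) {X : Ω → ι → U} (hX : KWiseUniform d X) (b : U → β)
    (hb : ∀ j, 𝔼 u, (if b u = j then 1 else 0 : ℝ) ≤ 2 / Fintype.card β) (H : Finset ι) :
    𝔼 ω, (if ∃ j, T ≤ (H.filter fun i => b (X ω i) = j).card then 1 else 0 : ℝ) ≤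
      Fintype.card β * (2 * H.card / Fintype.card β) ^ T := by
  calc _ ≤ 𝔼 ω, ∑ j, ∑ g : Fin T ↪ H, ∏ k, (if b (X ω (g k)) = j then 1 else 0 : ℝ) := by
        refine Finset.expect_le_expect fun ω _ => ?_
        have h0 : ∀ j, ∀ g : Fin T ↪ H, (0 : ℝ) ≤
            ∏ k, (if b (X ω (g k)) = j then 1 else 0 : ℝ) :=
          fun j g => Finset.prod_nonneg fun k _ => by split_ifs <;> simp
        have h1 : ∀ j, 0 ≤ ∑ g : Fin T ↪ H, ∏ k, (if b (X ω (g k)) = j then 1 else 0 : ℝ) :=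
          fun j => Finset.sum_nonneg fun g _ => h0 j g
        split_ifs with h
        · obtain ⟨j, hj⟩ := h
          obtain ⟨e⟩ : Nonempty (Fin T ↪ (H.filter fun i => b (X ω i) = j)) :=
            Function.Embedding.nonempty_of_card_le (by simpa using hj)
          let g : Fin T ↪ H := ⟨fun k => ⟨e k, (Finset.mem_filter.mp (e k).2).1⟩, fun k k' hk =>
            e.injective (Subtype.ext (Subtype.mk.inj hk))⟩
          have hg : ∀ k, b (X ω (g k)) = j := fun k => (Finset.mem_filter.mp (e k).2).2
          refine le_trans ?_ (Finset.single_le_sum (fun j _ => h1 j) (Finset.mem_univ j))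
          refine le_trans ?_ (Finset.single_le_sum (fun g _ => h0 j g) (Finset.mem_univ g))
          simp [hg]
        · exact Finset.sum_nonneg fun j _ => h1 j
    _ = ∑ j, ∑ g : Fin T ↪ H, ∏ k : Fin T, 𝔼 u, (if b u = j then 1 else 0 : ℝ) := by
        rw [Finset.expect_sum_comm]
        refine Finset.sum_congr rfl fun j _ => ?_
        rw [Finset.expect_sum_comm]
        refine Finset.sum_congr rfl fun g _ => ?_
        exact hX (Fin T) (fun k => g k) (fun k u => if b u = j then 1 else 0)
          (Subtype.val_injective.comp g.injective) (by simpa using hT)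
    _ ≤ ∑ j : β, ∑ g : Fin T ↪ H, (2 / (Fintype.card β : ℝ)) ^ T := by
        refine Finset.sum_le_sum fun j _ => Finset.sum_le_sum fun g _ => ?_
        rw [Finset.prod_const, Finset.card_univ, Fintype.card_fin]
        exact pow_le_pow_left₀ (Finset.expect_nonneg fun u _ => by split_ifs <;> simp) (hb j) T
    _ ≤ _ := by
        simp only [Finset.sum_const, Finset.card_univ, nsmul_eq_mul]
        refine mul_le_mul_of_nonneg_left ?_ (Nat.cast_nonneg _)
        rw [mul_comm 2, mul_div_assoc, mul_pow]
        refine mul_le_mul_of_nonneg_right ?_ (by positivity)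
        have : Fintype.card (Fin T ↪ H) ≤ H.card ^ T := by
          rw [Fintype.card_embedding_eq, Fintype.card_fin, Fintype.card_coe]
          exact Nat.descFactorial_le_pow _ _
        exact_mod_cast this

open Classical in
/-- With high probability, hashing and signing does not increase the norm much. -/
theorem expect_bad_level_le [Nonempty β] [Nonempty U'] [Nonempty Ω'] [Nonempty Ω] {q : ℕ}
    (hq : 0 < q) (hqe : Even q)
    {X : Ω → ι → U} (hX : KWiseUniform (2 * q) X) {X' : Ω' → ι → U'}
    (hX' : KWiseUniform (2 * q) X') (b : U → β)
    (hb : ∀ j, 𝔼 u, (if b u = j then 1 else 0 : ℝ) ≤ 2 / Fintype.card β)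
    (σ : U' → ℝ) (hσ : ∀ u, |σ u| ≤ 1) (hμ : Fintype.card ι * (𝔼 u, σ u) ^ 2 ≤ 1)
    {w : ι → ℝ} (hw : ∑ i, w i ^ 2 ≤ 1) (hρ : 64 ≤ √(Fintype.card β : ℝ)) :
    (16 : ℝ) ^ q * 𝔼 ω, 𝔼 ω', (if 3 * (2 * q + 5 + 1024 * q ^ 2 : ℝ) <
      ∑ j, bucketSum (fun i => b (X ω i)) (fun i => w i * σ (X' ω' i)) j ^ 2 then 1 else 0 : ℝ) ≤
      √(Fintype.card β) ^ 3 / √(Fintype.card β) ^ q := by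
  set μ := 𝔼 u, σ u with hμdef
  set m := (Fintype.card β : ℝ) with hm
  set ρ := √m with hρdef
  have hρ0 : 0 < ρ := by linarith
  have hmρ : m = ρ ^ 2 := (Real.sq_sqrt (Nat.cast_nonneg _)).symm
  have hqR : (0 : ℝ) < q := by exact_mod_cast hq
  have hμ1 : |μ| ≤ 1 := (Finset.abs_expect_le _ _).trans
    (Finset.expect_le Finset.univ_nonempty fun u _ => hσ u)
  let H : Finset ι := Finset.univ.filter fun i => 1 / ρ < w i ^ 2
  set wl : ι → ℝ := fun i => if i ∈ H then 0 else w i with hwl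
  have hH : (H.card : ℝ) ≤ ρ := by
    have h1 : (H.card : ℝ) * (1 / ρ) ≤ ∑ i ∈ H, w i ^ 2 := by
      rw [← nsmul_eq_mul]
      exact Finset.card_nsmul_le_sum _ _ _ fun i hi => (Finset.mem_filter.mp hi).2.le
    have h2 : ∑ i ∈ H, w i ^ 2 ≤ 1 :=
      (Finset.sum_le_sum_of_subset_of_nonneg (Finset.subset_univ _)
        fun i _ _ => sq_nonneg _).trans hw
    have h3 := h1.trans h2
    rwa [mul_one_div, div_le_one hρ0] at h3
  have hwl1 : ∑ i, wl i ^ 2 ≤ 1 := by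
    refine (Finset.sum_le_sum fun i _ => ?_).trans hw
    simp only [hwl]; split_ifs
    · simpa using sq_nonneg (w i)
    · exact le_rfl
  have hwl2 : ∀ i, wl i ^ 2 ≤ 1 / ρ := by
    intro i
    simp only [hwl]; split_ifs with h
    · rw [zero_pow two_ne_zero]; positivity
    · by_contra hc
      exact h (Finset.mem_filter.mpr ⟨Finset.mem_univ _, not_le.mp hc⟩)
  have hmom := expect_crossTerm_pow_le le_rfl hX hX' b hb (fun u => σ u - μ)
    (by rw [Finset.expect_sub_distrib, Fintype.expect_const, hμdef, sub_self])
    (fun u => (abs_sub _ _).trans (by linarith [hσ u])) hwl1 hwl2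
  have hload := expect_load_le (T := 2 * q) le_rfl hX b hb H
  have hpoint : ∀ ω ω', (if 3 * (2 * q + 5 + 1024 * q ^ 2 : ℝ) <
      ∑ j, bucketSum (fun i => b (X ω i)) (fun i => w i * σ (X' ω' i)) j ^ 2 then 1 else 0 : ℝ) ≤
      (if ∃ j, 2 * q ≤ (H.filter fun i => b (X ω i) = j).card then 1 else 0 : ℝ) +
      crossTerm wl (fun i => b (X ω i)) (fun i => σ (X' ω' i) - μ) ^ q / (1024 * q ^ 2) ^ q := by
    intro ω ω'
    have hnn : (0 : ℝ) ≤ crossTerm wl (fun i => b (X ω i)) (fun i => σ (X' ω' i) - μ) ^ q /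
      (1024 * q ^ 2) ^ q := div_nonneg (hqe.pow_nonneg _) (pow_nonneg (by positivity) _)
    by_cases hl : ∃ j, 2 * q ≤ (H.filter fun i => b (X ω i) = j).card
    · rw [if_pos hl]
      split_ifs <;> linarith
    · rw [if_neg hl, zero_add]
      split_ifs with hbad
      swap
      · exact hnn
      rw [one_le_div (by positivity)]
      refine pow_le_pow_left₀ (by positivity) ?_ q
      by_contra hc
      push Not at hl
      have := sum_bucketSum_sq_le hw (fun i => hσ (X' ω' i)) hμ1 hμ (T := 2 * q)
        (fun j => (hl j).le) (not_le.mp hc).le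
      push_cast at this
      linarith
  have hsum : 𝔼 ω, 𝔼 ω', (if 3 * (2 * q + 5 + 1024 * q ^ 2 : ℝ) <
      ∑ j, bucketSum (fun i => b (X ω i)) (fun i => w i * σ (X' ω' i)) j ^ 2 then 1 else 0 : ℝ) ≤
      m * (2 * H.card / m) ^ (2 * q) +
        3 * (16 / ρ) ^ q * (2 * q : ℝ) ^ (2 * q) / (1024 * q ^ 2) ^ q := by
    refine (Finset.expect_le_expect fun ω _ => Finset.expect_le_expect fun ω' _ =>
      hpoint ω ω').trans ?_
    simp only [Finset.expect_add_distrib, Fintype.expect_const, ← Finset.expect_div]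
    exact add_le_add hload (div_le_div_of_nonneg_right hmom (by positivity))
  refine (mul_le_mul_of_nonneg_left hsum (by positivity)).trans ?_
  have h1 : (2 * H.card / m : ℝ) ≤ 2 / ρ := by
    rw [hmρ, div_le_div_iff₀ (by positivity) hρ0]
    nlinarith
  have h2 : (16 : ℝ) ^ q * (m * (2 * H.card / m) ^ (2 * q)) ≤ ρ ^ 2 / ρ ^ q := by
    calc (16 : ℝ) ^ q * (m * (2 * H.card / m) ^ (2 * q))
        ≤ (16 : ℝ) ^ q * (m * (2 / ρ) ^ (2 * q)) :=
          mul_le_mul_of_nonneg_left (mul_le_mul_of_nonneg_left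
            (pow_le_pow_left₀ (div_nonneg (mul_nonneg zero_le_two (Nat.cast_nonneg _)) (Nat.cast_nonneg _)) h1 _)
            (Nat.cast_nonneg _)) (by positivity)
      _ = ρ ^ 2 * (64 / ρ ^ 2) ^ q := by
          rw [hmρ, pow_mul, mul_left_comm, ← mul_pow]
          congr 2; ring
      _ ≤ ρ ^ 2 * (1 / ρ) ^ q := by
          refine mul_le_mul_of_nonneg_left (pow_le_pow_left₀ (by positivity) ?_ q) (by positivity)
          rw [div_le_div_iff₀ (by positivity) hρ0]
          nlinarith
      _ = _ := by rw [one_div, inv_pow, div_eq_mul_inv]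
  have h3 : (16 : ℝ) ^ q * (3 * (16 / ρ) ^ q * (2 * q : ℝ) ^ (2 * q) / (1024 * q ^ 2) ^ q) =
      3 / ρ ^ q := by
    rw [pow_mul (2 * q : ℝ)]
    have : (16 : ℝ) ^ q * (3 * (16 / ρ) ^ q * ((2 * q : ℝ) ^ 2) ^ q / (1024 * q ^ 2) ^ q) =
        3 * (16 * (16 / ρ) * (2 * q : ℝ) ^ 2 / (1024 * q ^ 2)) ^ q := by
      simp only [div_pow, mul_pow (_ * _), mul_pow (16 : ℝ)]; field_simp
    rw [this, show (16 * (16 / ρ) * (2 * q : ℝ) ^ 2 / (1024 * q ^ 2)) = ρ⁻¹ by field_simp; norm_num,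
      inv_pow, div_eq_mul_inv]
  rw [mul_add, h3]
  refine (add_le_add_left h2 _).trans ?_
  rw [← add_div]
  refine div_le_div_of_nonneg_right ?_ (by positivity)
  nlinarith [sq_nonneg ρ, mul_le_mul_of_nonneg_right hρ (sq_nonneg ρ)]

end Level

theorem card_filter_mod_le {α : Type} [Fintype α] (f : α → ℕ) (hf : Function.Injective f) {M : ℕ}
    (hM : ∀ a, f a < M) (k j : ℕ) : (Finset.univ.filter fun a => f a % k = j).card ≤ M / k + 1 := by
  rw [← Finset.card_range (M / k + 1)]
  refine Finset.card_le_card_of_injOn (fun a => f a / k) (fun a _ => ?_) fun a ha a' ha' h => ?_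
  · simpa using Nat.lt_succ_iff.mpr (Nat.div_le_div_right (hM a).le)
  · apply hf
    rw [← Nat.div_add_mod (f a) k, ← Nat.div_add_mod (f a') k, (Finset.mem_filter.mp ha).2,
      (Finset.mem_filter.mp ha').2]
    simp only at h
    rw [h]

/-- The number with binary digits `z`. -/
def bitsValue {b : ℕ} (z : Fin b → Bool) : ℕ := ∑ t, (z t).toNat * 2 ^ (t : ℕ)

theorem bitsValue_eq {b : ℕ} (z : Fin b → Bool) :
    bitsValue z = (finFunctionFinEquiv fun t => if z t then (1 : Fin 2) else 0 : Fin (2 ^ b)) := by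
  rw [finFunctionFinEquiv_apply, bitsValue]
  refine Finset.sum_congr rfl fun t _ => ?_
  cases z t <;> simp

theorem bitsValue_lt {b : ℕ} (z : Fin b → Bool) : bitsValue z < 2 ^ b := by
  rw [bitsValue_eq]
  exact Fin.is_lt _

theorem bitsValue_injective (b : ℕ) : Function.Injective (bitsValue (b := b)) := by
  intro z z' h
  rw [bitsValue_eq, bitsValue_eq] at h
  have h1 := finFunctionFinEquiv.injective (Fin.ext h)
  funext t
  have := congrFun h1 t
  cases hz : z t <;> cases hz' : z' t <;> simp_all

theorem expect_comp_pi_le {κ A B : Type} [Fintype κ] [DecidableEq κ] [Fintype A] [Fintype B]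
    [DecidableEq B] [Nonempty A] [Nonempty B] (g : A → B) {L : ℝ}
    (hg : ∀ b, ((Finset.univ.filter fun a => g a = b).card : ℝ) ≤
      L * (Fintype.card A / Fintype.card B))
    (F : (κ → B) → ℝ) (hF : ∀ c, 0 ≤ F c) :
    𝔼 Y : κ → A, F (fun k => g (Y k)) ≤ L ^ Fintype.card κ * 𝔼 c, F c := by
  have h1 : ∀ c : κ → B, ∑ Y : κ → A with (fun k => g (Y k)) = c, F (fun k => g (Y k)) ≤
      (L * (Fintype.card A / Fintype.card B)) ^ Fintype.card κ * F c := by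
    intro c
    rw [Finset.sum_congr rfl (g := fun _ => F c)
      (fun Y hY => by rw [(Finset.mem_filter.mp hY).2]), Finset.sum_const, nsmul_eq_mul]
    refine mul_le_mul_of_nonneg_right ?_ (hF c)
    have h2 : (Finset.univ.filter fun Y : κ → A => (fun k => g (Y k)) = c) =
        Fintype.piFinset fun k => Finset.univ.filter fun a => g a = c k := by
      ext Y
      simp [funext_iff]
    rw [h2, Fintype.card_piFinset, Nat.cast_prod]
    refine (Finset.prod_le_prod (fun _ _ => Nat.cast_nonneg _) fun k _ => hg (c k)).trans ?_
    rw [Finset.prod_const, Finset.card_univ]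
  have hA : (Fintype.card A : ℝ) ≠ 0 := by exact_mod_cast Fintype.card_ne_zero
  have hB : (Fintype.card B : ℝ) ≠ 0 := by exact_mod_cast Fintype.card_ne_zero
  rw [Fintype.expect_eq_sum_div_card, Fintype.expect_eq_sum_div_card, Fintype.card_fun,
    Fintype.card_fun, ← Finset.sum_fiberwise (s := Finset.univ) (g := fun (Y : κ → A) k => g (Y k))]
  rw [div_le_iff₀ (by positivity)]
  refine (Finset.sum_le_sum fun c _ => h1 c).trans (le_of_eq ?_)
  rw [← Finset.mul_sum, mul_pow, div_pow]
  push_cast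
  field_simp

theorem expect_seed_le {p d b S : ℕ} [Fact p.Prime] (hS : S = 2 * d * b) (hp : p ≤ 2 ^ b)
    (F : (Fin d → ZMod p) → (Fin d → ZMod p) → ℝ) (hF : ∀ c c', 0 ≤ F c c') :
    𝔼 y : Fin S → Bool, F (fun j => (blockValue (seedBits y) b j : ℕ))
      (fun j => (blockValue (fun t => seedBits y (d * b + t)) b j : ℕ)) ≤
      (4 : ℝ) ^ d * 𝔼 c, 𝔼 c', F c c' := by
  subst hS
  let E : (Fin 2 × Fin d) × Fin b ≃ Fin (2 * d * b) :=
    (finProdFinEquiv.prodCongr (Equiv.refl _)).trans finProdFinEquiv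
  have hE : ∀ i j t, ((E ((i, j), t) : Fin _) : ℕ) = i * (d * b) + (j * b + t) := by
    intro i j t
    simp only [E, Equiv.trans_apply, Equiv.prodCongr_apply, Prod.map_apply, Equiv.refl_apply,
      finProdFinEquiv_apply_val]
    ring
  have hblock : ∀ (y : Fin (2 * d * b) → Bool) (i : Fin 2) (j : Fin d),
      blockValue (fun t => seedBits y (i * (d * b) + t)) b j =
        bitsValue fun t => y (E ((i, j), t)) := by
    intro y i j
    rw [blockValue, bitsValue, Finset.sum_range]
    refine Finset.sum_congr rfl fun t _ => ?_
    rw [← hE, seedBits, dif_pos (Fin.is_lt _)]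
  have h1 : 𝔼 y : Fin (2 * d * b) → Bool, F (fun j => (blockValue (seedBits y) b j : ℕ))
      (fun j => (blockValue (fun t => seedBits y (d * b + t)) b j : ℕ)) =
      𝔼 Y : Fin 2 × Fin d → Fin b → Bool,
        F (fun j => (bitsValue (Y (0, j)) : ℕ)) (fun j => (bitsValue (Y (1, j)) : ℕ)) := by
    refine Fintype.expect_equiv ((E.arrowCongr (Equiv.refl Bool)).symm.trans
      (Equiv.curry _ _ _)) _ _ fun y => ?_
    have h0 : ∀ j : Fin d, blockValue (seedBits y) b j = bitsValue fun t => y (E ((0, j), t)) :=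
      fun j => by rw [← hblock]; simp
    have h1 : ∀ j : Fin d, blockValue (fun t => seedBits y (d * b + t)) b j =
        bitsValue fun t => y (E ((1, j), t)) := fun j => by rw [← hblock]; simp
    simp only [h0, h1]
    rfl
  have h2 := expect_comp_pi_le (κ := Fin 2 × Fin d) (A := Fin b → Bool) (B := ZMod p)
    (fun z => (bitsValue z : ZMod p)) (L := 2) (fun c => ?_)
    (fun c => F (fun j => c (0, j)) (fun j => c (1, j))) (fun c => hF _ _)
  · rw [h1]
    refine h2.trans (le_of_eq ?_)
    congr 1
    · rw [Fintype.card_prod, Fintype.card_fin, Fintype.card_fin, pow_mul]; norm_num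
    · have h3 := Finset.expect_product' (Finset.univ : Finset (Fin d → ZMod p))
        (Finset.univ : Finset (Fin d → ZMod p)) F
      rw [← h3, Finset.univ_product_univ]
      exact Fintype.expect_equiv ((Equiv.curry _ _ _).trans (finTwoArrowEquiv _)) _ _ fun c => rfl
  · have hp0 : 0 < p := (Fact.out : p.Prime).pos
    have h3 : (Finset.univ.filter fun z : Fin b → Bool => (bitsValue z : ZMod p) = c).card ≤
        2 ^ b / p + 1 := by
      refine le_trans (Finset.card_le_card fun z hz => ?_)
        (card_filter_mod_le bitsValue (bitsValue_injective b) bitsValue_lt p c.val)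
      have := congrArg ZMod.val (Finset.mem_filter.mp hz).2
      rw [ZMod.val_natCast] at this
      exact Finset.mem_filter.mpr ⟨Finset.mem_univ _, this⟩
    have h4 : (((2 ^ b / p : ℕ) : ℝ)) ≤ 2 ^ b / p := by exact_mod_cast Nat.cast_div_le
    have h5 : (1 : ℝ) ≤ 2 ^ b / p := by
      rw [one_le_div (by exact_mod_cast hp0)]
      exact_mod_cast hp
    calc _ ≤ ((2 ^ b / p + 1 : ℕ) : ℝ) := by exact_mod_cast h3
      _ ≤ 2 * (2 ^ b / p) := by push_cast at h4 ⊢; linarith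
      _ = _ := by simp [ZMod.card]

theorem expect_mod_eq_le {p m : ℕ} [NeZero p] (hm : 0 < m) (hmp : m ≤ p) (j : Fin m) :
    𝔼 u : ZMod p, (if (⟨u.val % m, Nat.mod_lt _ hm⟩ : Fin m) = j then 1 else 0 : ℝ) ≤
      2 / Fintype.card (Fin m) := by
  rw [Fintype.expect_eq_sum_div_card, Finset.sum_boole, ZMod.card, Fintype.card_fin]
  have hp0 : (0 : ℝ) < p := by exact_mod_cast hm.trans_le hmp
  have hm0 : (0 : ℝ) < m := by exact_mod_cast hm
  have h3 := card_filter_mod_le (fun u : ZMod p => u.val) (ZMod.val_injective p)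
    (fun u => ZMod.val_lt u) m j
  have h4 : ((p / m : ℕ) : ℝ) ≤ p / m := Nat.cast_div_le
  have h5 : (1 : ℝ) ≤ p / m := by
    rw [one_le_div hm0]
    exact_mod_cast hmp
  rw [div_le_div_iff₀ hp0 hm0]
  have h6 : ((Finset.univ.filter fun u : ZMod p =>
      (⟨u.val % m, Nat.mod_lt _ hm⟩ : Fin m) = j).card : ℝ) ≤ 2 * (p / m) := by
    simp only [Fin.ext_iff]
    calc _ ≤ ((p / m + 1 : ℕ) : ℝ) := by exact_mod_cast h3
      _ ≤ _ := by push_cast; linarith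
  calc _ ≤ 2 * (p / m : ℝ) * m := mul_le_mul_of_nonneg_right h6 hm0.le
    _ = 2 * p := by field_simp

theorem mul_sq_expect_sign_le {N p : ℕ} [NeZero p] (hNp : N ≤ p) :
    (N : ℝ) * (𝔼 u : ZMod p, (-1 : ℝ) ^ (u.val % 2)) ^ 2 ≤ 1 := by
  have h1 : ∑ u : ZMod p, (-1 : ℝ) ^ (u.val % 2) = if Even p then 0 else 1 := by
    rw [← neg_one_geom_sum, Finset.sum_range]
    obtain ⟨n, rfl⟩ : ∃ n, p = n + 1 := ⟨p - 1, by have := NeZero.ne p; omega⟩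
    refine Finset.sum_congr rfl fun u _ => ?_
    rw [← neg_one_pow_eq_pow_mod_two]
    rfl
  have hp1 : (1 : ℝ) ≤ p := by exact_mod_cast Nat.one_le_iff_ne_zero.mpr (NeZero.ne p)
  have hN : (N : ℝ) ≤ p := by exact_mod_cast hNp
  rw [Fintype.expect_eq_sum_div_card, h1, ZMod.card]
  split_ifs
  · simp
  · rw [div_pow, one_pow, mul_one_div, div_le_one (by positivity)]
    nlinarith

theorem polyValue_eq_val (p d b : ℕ) (Y : ℕ → ℕ) (x : ℕ) :
    polyValue p d b Y x =
      (∑ j : Fin d, ((blockValue Y b j : ℕ) : ZMod p) * (x : ZMod p) ^ (j : ℕ)).val := by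
  rw [polyValue, ← ZMod.val_natCast, Finset.sum_range]
  push_cast
  rfl

/-- The vector that remains after one level. -/
def levelVector (e q : ℕ) (Y : ℕ → ℕ) (w : ℕ → ℝ) (j : ℕ) : ℝ :=
  ∑ i ∈ Finset.range (2 ^ 2 ^ e) with levelHash e q Y i = j, w i * (-1) ^ levelBit e q Y i

open Classical in
theorem expect_bad_levelVector_le {e q : ℕ} (he : 5 ≤ e) (hq : 0 < q) (hqe : Even q) {w : ℕ → ℝ}
    (hw : ∑ i ∈ Finset.range (2 ^ 2 ^ e), w i ^ 2 ≤ 1) :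
    𝔼 y : Fin (levelSeed e q) → Bool, (if 3 * (2 * q + 5 + 1024 * q ^ 2 : ℝ) <
      ∑ j ∈ Finset.range (2 ^ 2 ^ (e - 1)), levelVector e q (seedBits y) w j ^ 2 then 1 else 0 : ℝ) ≤
      √(2 ^ 2 ^ (e - 1)) ^ 3 / √(2 ^ 2 ^ (e - 1)) ^ q := by
  set N := 2 ^ 2 ^ e with hN
  set m := 2 ^ 2 ^ (e - 1) with hm
  have hm0 : 0 < m := Nat.two_pow_pos _
  have hNm : N = m ^ 2 := by
    rw [hN, hm, ← pow_mul, ← pow_succ, Nat.sub_add_cancel (by omega)]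
  have hm16 : 2 ^ 16 ≤ m := by
    refine Nat.pow_le_pow_right (by norm_num) ?_
    calc 16 = 2 ^ 4 := by norm_num
      _ ≤ 2 ^ (e - 1) := Nat.pow_le_pow_right (by norm_num) (by omega)
  set p := fieldSize N with hp
  have hNp : N ≤ p := le_fieldSize N
  have : Fact p.Prime := ⟨fieldSize_prime (Nat.two_pow_pos _).ne'⟩
  have hpb : p ≤ 2 ^ 2 ^ (e + 1) := by
    refine (fieldSize_le N).trans ?_
    rw [pow_succ, mul_two, pow_add, ← hN]
    exact Nat.mul_le_mul_right _ (by nlinarith)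
  let x : Fin N → ZMod p := fun i => ((i : ℕ) : ZMod p)
  have hx : Function.Injective x := by
    intro i i' h
    have h1 := congrArg ZMod.val h
    rw [ZMod.val_natCast_of_lt (i.2.trans_le hNp), ZMod.val_natCast_of_lt (i'.2.trans_le hNp)] at h1
    exact Fin.ext h1
  let X : (Fin (2 * q) → ZMod p) → Fin N → ZMod p := fun c i => ∑ j, c j * x i ^ (j : ℕ)
  have hX : KWiseUniform (2 * q) X := kWiseUniform_polynomial p (2 * q) x hx
  let bk : ZMod p → Fin m := fun u => ⟨u.val % m, Nat.mod_lt _ hm0⟩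
  let σ : ZMod p → ℝ := fun u => (-1) ^ (u.val % 2)
  have : Nonempty (Fin m) := ⟨⟨0, hm0⟩⟩
  have key := expect_bad_level_le hq hqe hX hX bk
    (fun j => expect_mod_eq_le hm0 ((by nlinarith : m ≤ N).trans hNp) j) σ (fun u => by simp [σ])
    (by rw [Fintype.card_fin]; exact mul_sq_expect_sign_le hNp)
    (w := fun i : Fin N => w i) (by rwa [Finset.sum_range] at hw)
    (by
      rw [Fintype.card_fin]
      refine Real.le_sqrt_of_sq_le ?_
      have : ((2 ^ 16 : ℕ) : ℝ) ≤ m := by exact_mod_cast hm16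
      push_cast at this
      linarith)
  let F : (Fin (2 * q) → ZMod p) → (Fin (2 * q) → ZMod p) → ℝ := fun c c' =>
    if 3 * (2 * q + 5 + 1024 * q ^ 2 : ℝ) <
      ∑ j, bucketSum (fun i => bk (X c i)) (fun i => w i * σ (X c' i)) j ^ 2 then 1 else 0
  have hseed := expect_seed_le (S := levelSeed e q) (by rw [levelSeed]; ring) hpb F
    (fun c c' => by simp only [F]; split_ifs <;> simp)
  have hvec : ∀ (y : Fin (levelSeed e q) → Bool),
      ∑ j ∈ Finset.range m, levelVector e q (seedBits y) w j ^ 2 =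
      ∑ j, bucketSum
        (fun i => bk (X (fun j => (blockValue (seedBits y) (2 ^ (e + 1)) j : ℕ)) i))
        (fun i => w i * σ (X (fun j => (blockValue
          (fun t => seedBits y (2 * q * 2 ^ (e + 1) + t)) (2 ^ (e + 1)) j : ℕ)) i)) j ^ 2 := by
    intro y
    rw [Finset.sum_range]
    refine Finset.sum_congr rfl fun j _ => ?_
    congr 1
    rw [levelVector, bucketSum, Finset.sum_filter, Finset.sum_filter, ← hN, Finset.sum_range]
    refine Finset.sum_congr rfl fun i _ => ?_
    simp only [levelHash, levelBit, polyValue_eq_val, Fin.ext_iff, bk, σ, X, x]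
    rfl
  rw [pow_mul] at hseed
  norm_num at hseed
  rw [Fintype.card_fin] at key
  have hfin := hseed.trans key
  push_cast [hm] at hfin ⊢
  refine le_trans (le_of_eq ?_) hfin
  refine Finset.expect_congr rfl fun y _ => ?_
  simp only [F]
  rw [← hvec]

theorem levelSeed_succ (e q : ℕ) : levelSeed e (2 * q) = levelSeed (e + 1) q := by
  rw [levelSeed, levelSeed, pow_succ 2 (e + 1)]; ring

theorem walk_succ (e q : ℕ) (Y : ℕ → ℕ) (i l : ℕ) :
    walk (e + 1) q Y i (l + 1) = walk e (2 * q) (fun t => Y (levelSeed (e + 1) q + t))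
      (levelHash (e + 1) q Y i) l := by
  induction l with
  | zero => simp [walk]
  | succ l ih =>
    rw [walk, ih, walk, levelSeed_succ, show e + 1 - (l + 1) = e - l by omega,
      show q * 2 ^ (l + 1) = 2 * q * 2 ^ l by ring]
    congr 1
    funext t
    congr 1
    ring

theorem signExp_succ (t e q : ℕ) (Y : ℕ → ℕ) (i : ℕ) :
    signExp (t + 1) (e + 1) q Y i = levelBit (e + 1) q Y i +
      signExp t e (2 * q) (fun t => Y (levelSeed (e + 1) q + t)) (levelHash (e + 1) q Y i) := by
  rw [signExp, Finset.sum_range_succ', add_comm, signExp]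
  congr 1
  · simp [walk]
  · refine Finset.sum_congr rfl fun l _ => ?_
    rw [walk_succ, levelSeed_succ, show e + 1 - (l + 1) = e - l by omega,
      show q * 2 ^ (l + 1) = 2 * q * 2 ^ l by ring]
    congr 1
    funext t
    congr 1
    ring

/-- The inner product of `w` with the signs after `t` levels. -/
def signSum (t e q : ℕ) (Y : ℕ → ℕ) (w : ℕ → ℝ) : ℝ :=
  ∑ i ∈ Finset.range (2 ^ 2 ^ e), w i * (-1) ^ signExp t e q Y i

theorem signSum_succ (t e q : ℕ) (Y : ℕ → ℕ) (w : ℕ → ℝ) :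
    signSum (t + 1) (e + 1) q Y w = signSum t e (2 * q)
      (fun t => Y (levelSeed (e + 1) q + t)) (levelVector (e + 1) q Y w) := by
  rw [signSum, signSum, ← Finset.sum_fiberwise_of_maps_to (g := levelHash (e + 1) q Y)
    (t := Finset.range (2 ^ 2 ^ e))
    (fun i _ => Finset.mem_range.mpr (Nat.mod_lt _ (Nat.two_pow_pos _)))]
  refine Finset.sum_congr rfl fun j _ => ?_
  rw [levelVector, Finset.sum_mul]
  refine Finset.sum_congr rfl fun i hi => ?_
  rw [signExp_succ, (Finset.mem_filter.mp hi).2, pow_add, mul_assoc]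

theorem signSum_mul (t e q : ℕ) (Y : ℕ → ℕ) (w : ℕ → ℝ) (a : ℝ) :
    signSum t e q Y (fun i => a * w i) = a * signSum t e q Y w := by
  simp only [signSum, Finset.mul_sum, mul_assoc]

theorem polyValue_congr {p d b : ℕ} {Y Y' : ℕ → ℕ} (h : ∀ t < d * b, Y t = Y' t) (x : ℕ) :
    polyValue p d b Y x = polyValue p d b Y' x := by
  rw [polyValue, polyValue]
  congr 1
  refine Finset.sum_congr rfl fun j hj => ?_
  congr 1
  refine Finset.sum_congr rfl fun t ht => ?_
  rw [h]
  rw [Finset.mem_range] at hj ht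
  calc j * b + t < j * b + b := by omega
    _ = (j + 1) * b := by ring
    _ ≤ d * b := Nat.mul_le_mul_right _ hj

theorem levelVector_congr {e q : ℕ} {Y Y' : ℕ → ℕ} (h : ∀ t < levelSeed e q, Y t = Y' t)
    (w : ℕ → ℝ) : levelVector e q Y w = levelVector e q Y' w := by
  have h1 : levelHash e q Y = levelHash e q Y' := by
    funext i
    rw [levelHash, levelHash, polyValue_congr fun t ht => h t (by rw [levelSeed]; omega)]
  have h2 : levelBit e q Y = levelBit e q Y' := by
    funext i
    rw [levelBit, levelBit, polyValue_congr fun t ht => h _ (by rw [levelSeed]; omega)]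
  funext j
  rw [levelVector, levelVector, h1, h2]

theorem seedBits_append_left {a b : ℕ} (y : Fin a → Bool) (y' : Fin b → Bool) {i : ℕ}
    (hi : i < a) : seedBits (Fin.append y y') i = seedBits y i := by
  rw [seedBits, seedBits, dif_pos (by omega), dif_pos hi]
  congr 1
  exact Fin.append_left y y' ⟨i, hi⟩

theorem seedBits_append_right {a b : ℕ} (y : Fin a → Bool) (y' : Fin b → Bool) (i : ℕ) :
    seedBits (Fin.append y y') (a + i) = seedBits y' i := by
  by_cases hi : i < b
  · rw [seedBits, seedBits, dif_pos (by omega), dif_pos hi]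
    congr 1
    exact Fin.append_right y y' ⟨i, hi⟩
  · rw [seedBits, seedBits, dif_neg (by omega), dif_neg hi]

theorem level_error_le {e q K : ℕ} (he : 2 ≤ e) (hK : 2 ^ e ≤ K) :
    √((2 : ℝ) ^ 2 ^ (e - 1)) ^ 3 / √((2 : ℝ) ^ 2 ^ (e - 1)) ^ q ≤
      (2 : ℝ) ^ K / 2 ^ (q * 2 ^ (e - 2)) := by
  have h1 : √((2 : ℝ) ^ 2 ^ (e - 1)) = 2 ^ 2 ^ (e - 2) := by
    rw [show e - 1 = e - 2 + 1 by omega, pow_succ, pow_mul, Real.sqrt_sq (by positivity)]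
  rw [h1, ← pow_mul, ← pow_mul, mul_comm q]
  refine div_le_div_of_nonneg_right (pow_le_pow_right₀ (by norm_num) ?_) (by positivity)
  obtain ⟨f, rfl⟩ : ∃ f, e = f + 2 := ⟨e - 2, by omega⟩
  rw [pow_add] at hK
  simp only [Nat.add_sub_cancel]
  omega

open Classical in
theorem expect_signSum_le {A : ℝ} {K M : ℕ} : ∀ (t e q r : ℕ), e = t + 4 → 0 < q → Even q →
    2 ^ e ≤ K → q * 2 ^ (e - 2) = M → 256 * (M : ℝ) ≤ A → r = t * levelSeed e q →
    ∀ w : ℕ → ℝ, ∑ i ∈ Finset.range (2 ^ 2 ^ e), w i ^ 2 ≤ 1 →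
    𝔼 y : Fin r → Bool, (if 256 * A ^ t < |signSum t e q (seedBits y) w| then 1 else 0 : ℝ) ≤
      t * ((2 : ℝ) ^ K / 2 ^ M) := by
  intro t
  induction t with
  | zero =>
    intro e q r he _ _ _ _ _ _ w hw
    have h : ∀ y : Fin r → Bool, ¬ 256 * A ^ 0 < |signSum 0 e q (seedBits y) w| := by
      intro y
      rw [not_lt, pow_zero, mul_one]
      refine abs_le_of_sq_le_sq ?_ (by norm_num)
      have h1 : signSum 0 e q (seedBits y) w = ∑ i ∈ Finset.range (2 ^ 2 ^ e), w i := by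
        simp [signSum, signExp]
      rw [h1]
      refine sq_sum_le_card_mul_sum_sq.trans ?_
      rw [Finset.card_range, he]
      norm_num at hw ⊢
      subst he
      norm_num at hw
      linarith
    simp only [if_neg (h _)]
    simp
  | succ t ih =>
    intro e q r he hq hqe hK hM hA hr w hw
    obtain ⟨f, rfl⟩ : ∃ f, e = f + 1 := ⟨e - 1, by omega⟩
    have hM' : 2 * q * 2 ^ (f - 2) = M := by
      rw [← hM, show f + 1 - 2 = f - 2 + 1 by omega, pow_succ]; ring
    have hf : 2 ^ f ≤ K := (Nat.pow_le_pow_right (by norm_num) (by omega)).trans hK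
    have hqM : q ≤ M := by
      rw [← hM]; exact Nat.le_mul_of_pos_right _ (Nat.two_pow_pos _)
    have hqM' : (q : ℝ) ≤ M := by exact_mod_cast hqM
    have hq1 : (1 : ℝ) ≤ q := by exact_mod_cast hq
    have hA0 : 0 < A := by linarith
    have hAq : 3 * (2 * q + 5 + 1024 * q ^ 2 : ℝ) ≤ A ^ 2 := by nlinarith
    obtain ⟨r', hr', rfl⟩ : ∃ r', r' = t * levelSeed f (2 * q) ∧ r = levelSeed (f + 1) q + r' :=
      ⟨_, rfl, by rw [hr, levelSeed_succ]; ring⟩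
    set S := levelSeed (f + 1) q with hS
    set δ := (2 : ℝ) ^ K / 2 ^ M with hδ
    have hδ0 : 0 ≤ δ := by positivity
    let Bad : (Fin S → Bool) → Prop := fun y => 3 * (2 * q + 5 + 1024 * q ^ 2 : ℝ) <
      ∑ j ∈ Finset.range (2 ^ 2 ^ f), levelVector (f + 1) q (seedBits y) w j ^ 2
    have hbad : 𝔼 y : Fin S → Bool, (if Bad y then 1 else 0 : ℝ) ≤ δ := by
      have h1 := expect_bad_levelVector_le (show 5 ≤ f + 1 by omega) hq hqe hw
      have h2 := level_error_le (q := q) (show 2 ≤ f + 1 by omega) hK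
      rw [hM] at h2
      exact h1.trans h2
    have hsum : ∀ (y : Fin S → Bool) (y' : Fin r' → Bool), signSum (t + 1) (f + 1) q (seedBits (Fin.append y y')) w =
        A * signSum t f (2 * q) (seedBits y')
          (fun i => A⁻¹ * levelVector (f + 1) q (seedBits y) w i) := by
      intro y y'
      rw [signSum_mul, mul_inv_cancel_left₀ hA0.ne', signSum_succ]
      congr 1
      · funext i; exact seedBits_append_right y y' i
      · exact levelVector_congr (fun i hi => seedBits_append_left y y' hi) w
    have hin : ∀ y : Fin S → Bool, 𝔼 y' : Fin r' → Bool, (if 256 * A ^ (t + 1) <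
        |signSum (t + 1) (f + 1) q (seedBits (Fin.append y y')) w| then 1 else 0 : ℝ) ≤
        (if Bad y then 1 else 0) + t * δ := by
      intro y
      by_cases hy : Bad y
      · rw [if_pos hy]
        have : (0 : ℝ) ≤ t * δ := by positivity
        refine (Finset.expect_le Finset.univ_nonempty (a := 1) fun y' _ => ?_).trans (by linarith)
        split_ifs <;> simp
      · rw [if_neg hy, zero_add]
        have hv : ∑ i ∈ Finset.range (2 ^ 2 ^ f),
            (A⁻¹ * levelVector (f + 1) q (seedBits y) w i) ^ 2 ≤ 1 := by
          simp only [mul_pow]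
          rw [← Finset.mul_sum, inv_pow, inv_mul_le_one₀ (by positivity)]
          exact (not_lt.mp hy).trans hAq
        refine le_trans (le_of_eq ?_) (ih f (2 * q) r' (by omega) (by omega) (even_two_mul q) hf hM'
          hA hr' _ hv)
        refine Finset.expect_congr rfl fun y' _ => ?_
        have : 256 * A ^ (t + 1) < |signSum (t + 1) (f + 1) q (seedBits (Fin.append y y')) w| ↔
            256 * A ^ t < |signSum t f (2 * q) (seedBits y')
              (fun i => A⁻¹ * levelVector (f + 1) q (seedBits y) w i)| := by
          rw [hsum, abs_mul, abs_of_pos hA0, pow_succ', mul_left_comm]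
          exact mul_lt_mul_iff_right₀ hA0
        simp only [this]
    have hsplit : 𝔼 y : Fin (S + r') → Bool, (if 256 * A ^ (t + 1) <
        |signSum (t + 1) (f + 1) q (seedBits y) w| then 1 else 0 : ℝ) =
        𝔼 y : Fin S → Bool, 𝔼 y' : Fin r' → Bool, (if 256 * A ^ (t + 1) <
        |signSum (t + 1) (f + 1) q (seedBits (Fin.append y y')) w| then 1 else 0 : ℝ) := by
      rw [← Finset.expect_product', Finset.univ_product_univ]
      exact Fintype.expect_equiv (Fin.appendEquiv S r').symm _ _ fun y => by
        rw [show Fin.append ((Fin.appendEquiv S r').symm y).1 ((Fin.appendEquiv S r').symm y).2 = y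
          from (Fin.appendEquiv S r').apply_symm_apply y]
    rw [hsplit]
    refine (Finset.expect_le_expect fun y _ => hin y).trans ?_
    rw [Finset.expect_add_distrib, Fintype.expect_const]
    push_cast
    linarith

theorem log_log_ge {n : ℕ} (hn : 3 ≤ n) : 0.08 ≤ Real.log (Real.log n) ∧ 1 ≤ Real.log n := by
  have h3 : (3 : ℝ) ≤ n := by exact_mod_cast hn
  have he : Real.exp 1 < 2.7182818286 := Real.exp_one_lt_d9
  have h1 : 1.09 ≤ Real.log n := by
    have h4 := Real.one_sub_inv_le_log_of_pos (show (0 : ℝ) < 3 / Real.exp 1 by positivity)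
    rw [Real.log_div (by norm_num) (Real.exp_pos 1).ne', Real.log_exp, inv_div] at h4
    have h5 : Real.log 3 ≤ Real.log n := Real.log_le_log (by norm_num) h3
    linarith
  refine ⟨?_, by linarith⟩
  have h6 := Real.one_sub_inv_le_log_of_pos (show (0 : ℝ) < Real.log n by linarith)
  have h7 : (Real.log n)⁻¹ ≤ 0.92 := by
    rw [inv_le_comm₀ (by linarith) (by norm_num)]
    norm_num at h1 ⊢
    linarith
  linarith

/-- The size of the parameters of the generator. -/
theorem parameter_bounds {n : ℕ} (hn : 3 ≤ n) {γ : ℝ} (hγ0 : 0 < γ) (hγ1 : γ < 1) :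
    1 ≤ γ * 2 ^ accuracyBits γ ∧
    (accuracyBits γ : ℝ) + 3 * 2 ^ topLevel n ≤ 21 * Real.log (n / γ) ∧
    (topLevel n : ℝ) ≤ 40 * Real.log (Real.log n) ∧ 1 ≤ Real.log (n / γ) ∧
    (n ≤ accuracyBits γ → (n : ℝ) ≤ 3 * Real.log (n / γ)) := by
  obtain ⟨hll, hl⟩ := log_log_ge hn
  have h3 : (3 : ℝ) ≤ n := by exact_mod_cast hn
  have hlog2 := Real.log_two_gt_d9
  have hlog2' := Real.log_two_lt_d9
  have hL : Real.log (n / γ) = Real.log n + Real.log (1 / γ) := by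
    rw [div_eq_mul_one_div, Real.log_mul (by linarith) (by positivity)]
  have hg0 : 0 < Real.log (1 / γ) := Real.log_pos (by rw [one_lt_div hγ0]; exact hγ1)
  have hk1 : Real.logb 2 (1 / γ) ≤ accuracyBits γ := Nat.le_ceil _
  have hlogb : Real.logb 2 (1 / γ) * Real.log 2 = Real.log (1 / γ) :=
    div_mul_cancel₀ _ (by linarith)
  have hk2 : (accuracyBits γ : ℝ) < Real.logb 2 (1 / γ) + 1 :=
    Nat.ceil_lt_add_one (Real.logb_nonneg (by norm_num) (by rw [le_div_iff₀ hγ0]; linarith))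
  have hK : (2 : ℝ) ^ topLevel n ≤ 6 * Real.log n := by
    have h4 : ((2 ^ topLevel n : ℕ) : ℝ) ≤ ((2 * Nat.clog 2 n + 1 : ℕ) : ℝ) := by
      exact_mod_cast two_pow_topLevel_le n
    have h5 : (2 : ℝ) ^ (Nat.clog 2 n - 1) ≤ n := by
      exact_mod_cast (Nat.pow_pred_clog_lt_self (b := 2) (by norm_num) (by omega : 1 < n)).le
    have h6 := Real.log_le_log (by positivity) h5
    rw [Real.log_pow] at h6
    have h7 : 0 < Nat.clog 2 n := Nat.clog_pos (by norm_num) (by omega)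
    rw [Nat.cast_sub h7] at h6
    push_cast at h4 h6
    nlinarith
  refine ⟨?_, ?_, ?_, by linarith, ?_⟩
  · have h4 : 1 / γ ≤ 2 ^ (accuracyBits γ : ℝ) :=
      (Real.logb_le_iff_le_rpow (by norm_num) (by positivity)).mp hk1
    rw [Real.rpow_natCast, div_le_iff₀ hγ0] at h4
    linarith
  · have h4 : Real.logb 2 (1 / γ) ≤ 1.5 * Real.log (1 / γ) := by
      have : 0 ≤ Real.logb 2 (1 / γ) :=
        Real.logb_nonneg (by norm_num) (by rw [le_div_iff₀ hγ0]; linarith)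
      nlinarith
    linarith
  · have h4 := Real.log_le_log (by positivity) hK
    rw [Real.log_pow, Real.log_mul (by norm_num) (by linarith)] at h4
    have h5 : Real.log 6 ≤ 2 := by
      rw [Real.log_le_iff_le_exp (by norm_num), show (2 : ℝ) = 1 + 1 by norm_num, Real.exp_add]
      have := Real.exp_one_gt_d9
      nlinarith
    nlinarith
  · intro hnk
    have h4 : (n : ℝ) ≤ accuracyBits γ := by exact_mod_cast hnk
    nlinarith

theorem moment_bounds (n k : ℕ) :
    4 * k + 8 * 2 ^ topLevel n ≤ topMoment n k * 2 ^ topLevel n ∧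
    topMoment n k * 2 ^ topLevel n ≤ 4 * k + 12 * 2 ^ topLevel n := by
  have hK : 0 < 2 ^ topLevel n := Nat.two_pow_pos _
  have h1 := Nat.div_add_mod k (2 ^ topLevel n)
  have h2 := Nat.mod_lt k hK
  have h3 : topMoment n k * 2 ^ topLevel n =
      4 * (2 ^ topLevel n * (k / 2 ^ topLevel n)) + 12 * 2 ^ topLevel n := by
    rw [topMoment]; ring
  constructor <;> omega

theorem seedLength_le {n : ℕ} (hn : 3 ≤ n) {γ : ℝ} (hγ0 : 0 < γ) (hγ1 : γ < 1) :
    (seedLength n (accuracyBits γ) : ℝ) ≤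
      26880 * Real.log (n / γ) * Real.log (Real.log n) := by
  obtain ⟨-, h1, h2, h3, -⟩ := parameter_bounds hn hγ0 hγ1
  have hll : 0 ≤ Real.log (Real.log n) := by linarith [(log_log_ge hn).1]
  have h4 : seedLength n (accuracyBits γ) ≤
      topLevel n * (32 * (accuracyBits γ + 3 * 2 ^ topLevel n)) := by
    rw [seedLength]
    split_ifs
    · refine Nat.mul_le_mul (Nat.sub_le _ _) ?_
      have := (moment_bounds n (accuracyBits γ)).2
      rw [levelSeed, pow_succ]
      nlinarith
    · exact Nat.zero_le _
  have h5 : (seedLength n (accuracyBits γ) : ℝ) ≤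
      topLevel n * (32 * (accuracyBits γ + 3 * 2 ^ topLevel n)) := by exact_mod_cast h4
  calc (seedLength n (accuracyBits γ) : ℝ)
      ≤ topLevel n * (32 * (accuracyBits γ + 3 * 2 ^ topLevel n)) := h5
    _ ≤ 40 * Real.log (Real.log n) * (32 * (21 * Real.log (n / γ))) := by gcongr
    _ = _ := by ring

theorem threshold_ge {n : ℕ} (hn : 3 ≤ n) {γ : ℝ} (hγ0 : 0 < γ) (hγ1 : γ < 1) :
    (5376 * Real.log (n / γ)) ^ (topLevel n + 2) ≤
      (5376 * Real.log (n / γ)) ^ (65 * Real.log (Real.log n)) := by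
  obtain ⟨-, -, h2, h3, -⟩ := parameter_bounds hn hγ0 hγ1
  have hll := (log_log_ge hn).1
  rw [← Real.rpow_natCast]
  refine Real.rpow_le_rpow_of_exponent_le (by linarith) ?_
  push_cast
  norm_num at hll
  linarith

theorem seedProb_le_expect {r : ℕ} {E : Set (Fin r → Bool)} {p : (Fin r → Bool) → Prop}
    [DecidablePred p] (h : ∀ y ∈ E, p y) : seedProb E ≤ 𝔼 y, (if p y then 1 else 0 : ℝ) := by
  rw [seedProb, Fintype.expect_eq_sum_div_card, Finset.sum_boole, Fintype.card_fun,
    Fintype.card_bool, Fintype.card_fin]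
  push_cast
  refine div_le_div_of_nonneg_right ?_ (by positivity)
  have h1 : E ⊆ (Finset.univ.filter p : Finset (Fin r → Bool)) := fun y hy => by simpa using h y hy
  have h2 := Set.ncard_le_ncard h1 (Finset.finite_toSet _)
  rw [Set.ncard_coe_finset] at h2
  exact_mod_cast h2

theorem abs_sum_sign_le {n : ℕ} {w : EuclideanSpace ℝ (Fin n)} (hw : ‖w‖ = 1) (x : Fin n → ℤˣ) :
    |∑ i, w i * ((x i : ℤ) : ℝ)| ≤ √n := by
  refine Real.abs_le_sqrt (sq_sum_le_card_mul_sum_sq.trans (le_of_eq ?_))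
  have h1 : ∑ i, w i ^ 2 = 1 := by rw [← EuclideanSpace.real_norm_sq_eq, hw, one_pow]
  have h2 : ∀ i, (w i * ((x i : ℤ) : ℝ)) ^ 2 = w i ^ 2 := fun i => by
    rcases Int.units_eq_one_or (x i) with h | h <;> simp [h]
  simp [h2, h1]

theorem sum_generator_eq {n k : ℕ} (hk : k < n) (y : Fin (seedLength n k) → Bool)
    (w : Fin n → ℝ) : ∑ i, w i * ((generator n k y i : ℤ) : ℝ) =
      signSum (topLevel n - 4) (topLevel n) (topMoment n k) (seedBits y)
        (fun i => if h : i < n then w ⟨i, h⟩ else 0) := by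
  rw [signSum, ← Finset.sum_subset (Finset.range_subset_range.mpr (le_two_pow_two_pow_topLevel n)),
    Finset.sum_range]
  · refine Finset.sum_congr rfl fun i _ => ?_
    rw [dif_pos i.2, generator, generatorBit, if_pos hk, neg_one_pow_eq_pow_mod_two]
    rcases Nat.mod_two_eq_zero_or_one (signExp (topLevel n - 4) (topLevel n) (topMoment n k)
      (seedBits y) i) with h | h <;> simp [h]
  · intro i _ hi
    rw [dif_neg (by simpa using hi), zero_mul]

theorem mainTheorem7 :
    ∃ (r : ℕ → ℕ → ℕ) (G : (n k : ℕ) → (Fin (r n k) → Bool) → (Fin n → ℤˣ)),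
      IsExplicitGenerator r G ∧
      ∃ C C₁ C₂ : ℝ, 0 < C ∧ 0 < C₁ ∧ 0 < C₂ ∧
        ∀ n : ℕ, 3 ≤ n → ∀ γ : ℝ, 0 < γ → γ < 1 →
          (r n (accuracyBits γ) : ℝ) ≤ C * Real.log (n / γ) * Real.log (Real.log n) ∧
          ∀ w : EuclideanSpace ℝ (Fin n), ‖w‖ = 1 →
            seedProb {y : Fin (r n (accuracyBits γ)) → Bool |
                (C₁ * Real.log (n / γ)) ^ (C₂ * Real.log (Real.log n)) ≤
                  |∑ i, w i * ((G n (accuracyBits γ) y i : ℤ) : ℝ)|} ≤ γ := by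
  classical
  refine ⟨seedLength, generator, isExplicitGenerator_generator, 26880, 5376, 65, by norm_num,
    by norm_num, by norm_num, fun n hn γ hγ0 hγ1 => ⟨seedLength_le hn hγ0 hγ1, fun w hw => ?_⟩⟩
  obtain ⟨hγ, h1, h2, h3, h4⟩ := parameter_bounds hn hγ0 hγ1
  have hthr := threshold_ge hn hγ0 hγ1
  set k := accuracyBits γ with hk
  set E := topLevel n with hE
  set B := 5376 * Real.log (n / γ) with hB
  have hB1 : 5376 ≤ B := by linarith
  by_cases hcase : k < n ∧ 4 ≤ E
  swap
  · have hnB : (n : ℝ) < B := by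
      by_cases hkn : k < n
      · have hE3 : E ≤ 3 := by
          by_contra hc
          exact hcase ⟨hkn, by omega⟩
        have : n ≤ 256 := (le_two_pow_two_pow_topLevel n).trans (by
          calc 2 ^ 2 ^ topLevel n ≤ 2 ^ 2 ^ 3 := Nat.pow_le_pow_right (by norm_num)
                (Nat.pow_le_pow_right (by norm_num) hE3)
            _ = 256 := by norm_num)
        have : (n : ℝ) ≤ 256 := by exact_mod_cast this
        linarith
      · linarith [h4 (not_lt.mp hkn)]
    have hempty : {y : Fin (seedLength n k) → Bool | B ^ (65 * Real.log (Real.log n)) ≤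
        |∑ i, w i * ((generator n k y i : ℤ) : ℝ)|} = ∅ := by
      refine Set.eq_empty_of_forall_notMem fun y hy => ?_
      have h5 : √(n : ℝ) ≤ n := by
        rw [Real.sqrt_le_left (Nat.cast_nonneg n)]
        have : (3 : ℝ) ≤ n := by exact_mod_cast hn
        nlinarith
      have h6 : B ≤ B ^ (E + 2) := le_self_pow₀ (by linarith) (by omega)
      have h7 := abs_sum_sign_le hw (generator n k y)
      have h8 : B ^ (65 * Real.log (Real.log n)) ≤ _ := hy
      linarith
    rw [hempty, seedProb, Set.ncard_empty]
    simpa using hγ0.le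
  · obtain ⟨hkn, hE4⟩ := hcase
    set q := topMoment n k with hq
    obtain ⟨hq1, hq2⟩ := moment_bounds n k
    rw [← hq, ← hE] at hq1 hq2
    have hqM : q * 2 ^ E = 4 * (q * 2 ^ (E - 2)) := by
      have : 2 ^ E = 2 ^ (E - 2) * 2 ^ 2 := by rw [← pow_add, Nat.sub_add_cancel (by omega)]
      rw [this]
      ring
    set M := q * 2 ^ (E - 2) with hM
    have hM1 : k + 2 * 2 ^ E ≤ M := by omega
    have hM2 : M ≤ k + 3 * 2 ^ E := by omega
    have hMB : 256 * (M : ℝ) ≤ B := by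
      have : (M : ℝ) ≤ k + 3 * 2 ^ E := by exact_mod_cast hM2
      linarith
    let v : ℕ → ℝ := fun i => if h : i < n then w ⟨i, h⟩ else 0
    have hv : ∑ i ∈ Finset.range (2 ^ 2 ^ E), v i ^ 2 ≤ 1 := by
      rw [← Finset.sum_subset (Finset.range_subset_range.mpr (le_two_pow_two_pow_topLevel n)),
        Finset.sum_range]
      · simp only [v, Fin.is_lt, dif_pos]
        rw [← EuclideanSpace.real_norm_sq_eq, hw, one_pow]
      · intro i _ hi
        simp only [v]
        rw [dif_neg (by simpa using hi)]
        norm_num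
    have key := expect_signSum_le (A := B) (K := 2 ^ E) (M := M) (E - 4) E q (seedLength n k)
      (by omega) (by rw [hq, topMoment]; omega) (by
        rw [hq, topMoment]
        exact ⟨2 * (k / 2 ^ topLevel n + 1) + 4, by ring⟩)
      le_rfl rfl hMB (by rw [seedLength, if_pos hkn]) v hv
    refine (seedProb_le_expect (p := fun y => 256 * B ^ (E - 4) <
      |signSum (E - 4) E q (seedBits y) v|) fun y hy => ?_).trans (key.trans ?_)
    · have h8 : B ^ (65 * Real.log (Real.log n)) ≤
        |∑ i, w i * ((generator n k y i : ℤ) : ℝ)| := hy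
      rw [sum_generator_eq hkn] at h8
      refine lt_of_lt_of_le ?_ (hthr.trans h8)
      have h9 : B ^ (E - 4) ≤ B ^ E := pow_le_pow_right₀ (by linarith) (Nat.sub_le _ _)
      have h10 : 0 < B ^ E := pow_pos (by linarith) _
      have h11 : 256 < B ^ 2 := by nlinarith
      rw [pow_add]
      nlinarith
    · have h9 : ((E - 4 : ℕ) : ℝ) ≤ 2 ^ 2 ^ E := by
        have : E - 4 ≤ 2 ^ 2 ^ E :=
          (Nat.sub_le _ _).trans (Nat.lt_two_pow_self.le.trans Nat.lt_two_pow_self.le)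
        exact_mod_cast this
      have h10 : (2 : ℝ) ^ (k + 2 * 2 ^ E) ≤ 2 ^ M := pow_le_pow_right₀ (by norm_num) hM1
      rw [← mul_div_assoc, div_le_iff₀ (by positivity)]
      calc ((E - 4 : ℕ) : ℝ) * 2 ^ 2 ^ E ≤ 2 ^ 2 ^ E * 2 ^ 2 ^ E := by gcongr
        _ = 1 * 2 ^ (2 * 2 ^ E) := by rw [one_mul, two_mul, pow_add]
        _ ≤ γ * 2 ^ k * 2 ^ (2 * 2 ^ E) := by gcongr
        _ = γ * 2 ^ (k + 2 * 2 ^ E) := by rw [pow_add]; ring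
        _ ≤ γ * 2 ^ M := by gcongr
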